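/- Let $r$ be a fixed positive integer. A graph is chordal if each of its cycles of length at least four has a chord. A graph is $r$-degenerate if every subgraph of it of order at least one has a vertex of degree at most $r$, and a matching $M$ in a graph $G$ is $r$-degenerate if the subgraph of $G$ induced by the set of vertices incident with an edge in $M$ is $r$-degenerate. Then there is a polynomial-time algorithm that, given a finite simple chordal graph $G$, computes the maximum size $\nu_r(G)$ of an $r$-degenerate matching in $G$. More precisely, there are a single program of a random access machine (with unit cost per instruction, whose arithmetic instructions are addition and truncated subtraction) and a polynomial $q$, both depending only on $r$, such that for every $n\geq 0$ and every chordal graph $G$ with vertex set $\{0,\ldots,n-1\}$, the program, started on $n$ and the adjacency matrix of $G$, halts after at most $q(n)$ steps with output $\nu_r(G)$. -/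

import Mathlib

/-- A graph is chordal if every cycle of length at least four has a chord, that is, an edge of the
graph between two vertices of the cycle that is not an edge of the cycle. -/
def IsChordal {V : Type*} (G : SimpleGraph V) : Prop :=
  ∀ (v : V) (c : G.Walk v v), c.IsCycle → 4 ≤ c.length →
    ∃ x ∈ c.support, ∃ y ∈ c.support, G.Adj x y ∧ s(x, y) ∉ c.edges

/-- A graph is `r`-degenerate if every subgraph of order at least one has a vertex of degree at
most `r` (in that subgraph). -/
def IsDegenerate {V : Type*} (G : SimpleGraph V) (r : ℕ) : Prop :=
  ∀ H : G.Subgraph, H.verts.Nonempty → ∃ v ∈ H.verts, (H.neighborSet v).encard ≤ (r : ℕ∞)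

/-- The sizes (numbers of edges) of the `r`-degenerate matchings `M` of `G`: the matchings such
that the subgraph of `G` induced by the set of vertices incident with an edge of `M` is
`r`-degenerate. -/
def degenerateMatchingSizes {V : Type*} (G : SimpleGraph V) (r : ℕ) : Set ℕ :=
  {k | ∃ M : G.Subgraph, M.IsMatching ∧ IsDegenerate (G.induce M.verts) r ∧ M.edgeSet.ncard = k}

/-! A random access machine with unit cost per instruction. There are registers `R₀, R₁, …` and
arrays `A₀, A₁, …` that hold natural numbers. A program is a finite text, and so it uses only
finitely many registers and arrays, with fixed names; array cells are addressed by the contents of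
registers. The arithmetic instructions are addition and truncated subtraction only: one step makes
the largest number present at most twice as large (or at most a constant of the program), so that
unit cost and logarithmic cost differ at most polynomially. -/

namespace RAM

/-- Programs. -/
inductive Prog : Type
  /-- do nothing -/
  | skip : Prog
  /-- `const i c` is `Rᵢ := c` -/
  | const (i c : ℕ) : Prog
  /-- `plus i j k` is `Rᵢ := Rⱼ + Rₖ` -/
  | plus (i j k : ℕ) : Prog
  /-- `monus i j k` is `Rᵢ := max (Rⱼ - Rₖ) 0` -/
  | monus (i j k : ℕ) : Prog
  /-- `load i a j` is `Rᵢ := Aₐ[Rⱼ]` -/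
  | load (i a j : ℕ) : Prog
  /-- `store a i j` is `Aₐ[Rᵢ] := Rⱼ` -/
  | store (a i j : ℕ) : Prog
  /-- `seq p q` is `p; q` -/
  | seq (p q : Prog) : Prog
  /-- `cond i p q` is `if Rᵢ ≠ 0 then p else q` -/
  | cond (i : ℕ) (p q : Prog) : Prog
  /-- `loop i p` is `while Rᵢ ≠ 0 do p` -/
  | loop (i : ℕ) (p : Prog) : Prog

/-- The contents of the registers and of the arrays. -/
structure State : Type where
  /-- `reg i` is the content of `Rᵢ` -/
  reg : ℕ → ℕ
  /-- `arr a k` is the content of the cell `Aₐ[k]` -/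
  arr : ℕ → ℕ → ℕ

/-- The state after `Rᵢ := x`. -/
def State.setReg (s : State) (i x : ℕ) : State :=
  { s with reg := Function.update s.reg i x }

/-- The state after `Aₐ[k] := x`. -/
def State.setArr (s : State) (a k x : ℕ) : State :=
  { s with arr := Function.update s.arr a (Function.update (s.arr a) k x) }

/-- `Exec p s t s'`: the program `p`, started in the state `s`, halts after exactly `t` steps, in
the state `s'`. Every assignment, every `skip` and every evaluation of the test of a conditional
or of a loop is one step. -/
inductive Exec : Prog → State → ℕ → State → Prop
  | skip (s : State) : Exec .skip s 1 s
  | const (s : State) (i c : ℕ) : Exec (.const i c) s 1 (s.setReg i c)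
  | plus (s : State) (i j k : ℕ) : Exec (.plus i j k) s 1 (s.setReg i (s.reg j + s.reg k))
  | monus (s : State) (i j k : ℕ) : Exec (.monus i j k) s 1 (s.setReg i (s.reg j - s.reg k))
  | load (s : State) (i a j : ℕ) : Exec (.load i a j) s 1 (s.setReg i (s.arr a (s.reg j)))
  | store (s : State) (a i j : ℕ) : Exec (.store a i j) s 1 (s.setArr a (s.reg i) (s.reg j))
  | seq {p q : Prog} {s s' s'' : State} {t t' : ℕ} :
      Exec p s t s' → Exec q s' t' s'' → Exec (.seq p q) s (t + t') s''
  | cond_true {i : ℕ} {p q : Prog} {s s' : State} {t : ℕ} :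
      s.reg i ≠ 0 → Exec p s t s' → Exec (.cond i p q) s (t + 1) s'
  | cond_false {i : ℕ} {p q : Prog} {s s' : State} {t : ℕ} :
      s.reg i = 0 → Exec q s t s' → Exec (.cond i p q) s (t + 1) s'
  | loop_done {i : ℕ} {p : Prog} {s : State} :
      s.reg i = 0 → Exec (.loop i p) s 1 s
  | loop_step {i : ℕ} {p : Prog} {s s' s'' : State} {t t' : ℕ} :
      s.reg i ≠ 0 → Exec p s t s' → Exec (.loop i p) s' t' s'' →
        Exec (.loop i p) s (t + t' + 1) s''

open Classical in
/-- The initial state for a graph `G` with vertices `0, …, n - 1`: register `R₀` holds `n`, array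
`A₀` holds the adjacency matrix of `G` row by row (entry `(i, j)` in the cell `i * n + j`), and
everything else is `0`. -/
noncomputable def graphInput {n : ℕ} (G : SimpleGraph (Fin n)) : State where
  reg i := if i = 0 then n else 0
  arr a k :=
    if a = 0 ∧ ∃ i j : Fin n, G.Adj i j ∧ k = (i : ℕ) * n + (j : ℕ) then 1 else 0

end RAM

/-!
An `r`-degenerate matching is a matching whose set `X` of covered vertices induces an `r`-degenerate
subgraph. A chordal graph has a perfect elimination ordering, which arises by repeatedly removing a
simplicial vertex (`IsChordal.exists_simplicial`). Since a vertex and its larger neighbours form a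
clique, `X` induces an `r`-degenerate subgraph if and only if every vertex of `X` has at most `r`
larger neighbours in `X` (`isDegenerate_induce_iff`). In particular, `X` contains at most `r + 1`
vertices of each of the cliques that consist of a vertex and its larger neighbours, and there are only
polynomially many such sets for fixed `r`.

The parent of a vertex is its smallest larger neighbour. The neighbours of a subtree of the resulting
elimination tree are among the root of the subtree and the larger neighbours of that root
(`IsPerfectElimination.adj_region`). So the maximum is found by dynamic programming along the tree:
for a part of the tree below a vertex `p`, the table tells for all small sets `S` and `T` and all `k`
whether there is a partial solution with `k` edges for which `S` is the set of relevant covered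
vertices outside of this part and `T` is the set of those vertices of `S` that are matched into
this part (`Feasible`). When the vertex `v` is processed, the part that hangs on `v` and `v` itself
are added to the part that hangs on the parent of `v`; the partial solutions split and combine
accordingly (`Feasible.split`, `Feasible.join`, `IsPerfectElimination.table_iff`).

The random access machine is programmed in a small language of expressions whose only loops are sums
over ranges bounded by variables, so that evaluating an expression takes polynomial time in any common
bound of the variables (`RAM.Expr.exec_comp`). With sums as existential quantifiers, this language
contains first-order formulas over `{0, …, N - 1}`. A further construct fills an array
cell by cell, where each cell is given by an expression that may read the previous cells
(`RAM.exec_tab`). The elimination ordering, the membership relation of the sets of at most `r + 1`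
vertices, coded by numbers with at most `r + 1` digits in base `n + 2`, and the table of the dynamic
program are three such arrays.
-/

/-! ### Expressions with bounded sums, and their compilation -/

namespace RAM

/-- Arithmetic expressions over variables `x₀, x₁, …` and arrays. All loops are sums whose range is
the value of a variable, so that the cost of evaluating an expression is bounded by a polynomial in
any common bound of the variables. -/
inductive Expr : Type
  /-- the variable `xᵢ` -/
  | var (i : ℕ) : Expr
  /-- a numeral -/
  | num (c : ℕ) : Expr
  /-- sum -/
  | add (e f : Expr) : Expr
  /-- truncated difference -/
  | sub (e f : Expr) : Expr
  /-- `get a e` is `Aₐ[e]` -/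
  | get (a : ℕ) (e : Expr) : Expr
  /-- `mulv e b` is `e * x_b` -/
  | mulv (e : Expr) (b : ℕ) : Expr
  /-- `sum i b e` is the sum of `e` over all `xᵢ < x_b`, where `xᵢ` is bound -/
  | sum (i b : ℕ) (e : Expr) : Expr

namespace Expr

/-- The value of an expression. -/
def eval : Expr → (ℕ → ℕ) → (ℕ → ℕ → ℕ) → ℕ
  | var i, ρ, _ => ρ i
  | num c, _, _ => c
  | add e f, ρ, A => e.eval ρ A + f.eval ρ A
  | sub e f, ρ, A => e.eval ρ A - f.eval ρ A
  | get a e, ρ, A => A a (e.eval ρ A)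
  | mulv e b, ρ, A => e.eval ρ A * ρ b
  | sum i b e, ρ, A => ∑ x ∈ Finset.range (ρ b), e.eval (Function.update ρ i x) A

/-- The program that evaluates an expression. The variable `xᵢ` lives in the register `R₂ᵢ`; the
registers with odd index are scratch space, of which only `R₂ₖ₊₁` with `d ≤ k` are used. The value
is left in `R₂d₊₁`. In the loops, `R₂d₊₅` counts down from the number of rounds, `R₂d₊₇` holds the
step `1`, and `R₂d₊₃` is the accumulator of a product or the saved value of a bound variable. -/
def comp : Expr → ℕ → Prog
  | var i, d => .seq (.const (2 * d + 1) 0) (.plus (2 * d + 1) (2 * i) (2 * d + 1))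
  | num c, d => .const (2 * d + 1) c
  | add e f, d => .seq (e.comp d) (.seq (f.comp (d + 1))
      (.plus (2 * d + 1) (2 * d + 1) (2 * (d + 1) + 1)))
  | sub e f, d => .seq (e.comp d) (.seq (f.comp (d + 1))
      (.monus (2 * d + 1) (2 * d + 1) (2 * (d + 1) + 1)))
  | get a e, d => .seq (e.comp d) (.load (2 * d + 1) a (2 * d + 1))
  | mulv e b, d => .seq (e.comp d) (.seq (.const (2 * d + 3) 0) (.seq (.const (2 * d + 5) 0)
      (.seq (.plus (2 * d + 5) (2 * b) (2 * d + 5)) (.seq (.const (2 * d + 7) 1)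
      (.seq (.loop (2 * d + 5) (.seq (.plus (2 * d + 3) (2 * d + 3) (2 * d + 1))
          (.monus (2 * d + 5) (2 * d + 5) (2 * d + 7))))
        (.plus (2 * d + 1) (2 * d + 3) (2 * d + 5)))))))
  | sum i b e, d => .seq (.const (2 * d + 1) 0) (.seq (.plus (2 * d + 3) (2 * i) (2 * d + 1))
      (.seq (.plus (2 * d + 5) (2 * b) (2 * d + 1)) (.seq (.const (2 * d + 7) 1)
      (.seq (.const (2 * i) 0)
      (.seq (.loop (2 * d + 5) (.seq (e.comp (d + 4))
          (.seq (.plus (2 * d + 1) (2 * d + 1) (2 * (d + 4) + 1))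
          (.seq (.plus (2 * i) (2 * i) (2 * d + 7)) (.monus (2 * d + 5) (2 * d + 5) (2 * d + 7))))))
        (.plus (2 * i) (2 * d + 3) (2 * d + 5)))))))

/-- A bound for the number of steps of `comp e d` as a polynomial in a common bound of all
variables. -/
noncomputable def cost : Expr → Polynomial ℕ
  | var _ => 2
  | num _ => 1
  | add e f => e.cost + (f.cost + 1)
  | sub e f => e.cost + (f.cost + 1)
  | get _ e => e.cost + 1
  | mulv e _ => e.cost + (Polynomial.X * 3 + 6)
  | sum _ _ e => Polynomial.X * (e.cost + 4) + 7

end Expr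

/-- The values of the variables in a state. -/
def State.env (s : State) : ℕ → ℕ := fun i => s.reg (2 * i)

/-- The loop rule for a loop that counts the register `c` down to `0`: `I j s` is an invariant that
holds after `j` rounds. -/
theorem exec_countdown {c N C : ℕ} {body : Prog} (I : ℕ → State → Prop)
    (step : ∀ j s, j < N → I j s → s.reg c = N - j →
      ∃ t s', Exec body s t s' ∧ t ≤ C ∧ I (j + 1) s' ∧ s'.reg c = N - (j + 1))
    {s : State} (h0 : I 0 s) (hc : s.reg c = N) :
    ∃ t s', Exec (.loop c body) s t s' ∧ t ≤ N * (C + 1) + 1 ∧ I N s' ∧ s'.reg c = 0 := by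
  have key : ∀ k j s, j + k = N → I j s → s.reg c = N - j →
      ∃ t s', Exec (.loop c body) s t s' ∧ t ≤ k * (C + 1) + 1 ∧ I N s' ∧ s'.reg c = 0 := by
    intro k
    induction k with
    | zero =>
      intro j s hj hI hs
      obtain rfl : j = N := by omega
      have h : s.reg c = 0 := by omega
      exact ⟨1, s, .loop_done h, by omega, hI, h⟩
    | succ k ih =>
      intro j s hj hI hs
      obtain ⟨t, s', he, ht, hI', hs'⟩ := step j s (by omega) hI hs
      obtain ⟨t', s'', he', ht', hI'', hs''⟩ := ih (j + 1) s' (by omega) hI' hs'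
      refine ⟨t + t' + 1, s'', .loop_step (by omega) he he', ?_, hI'', hs''⟩
      have : (k + 1) * (C + 1) = k * (C + 1) + (C + 1) := by ring
      omega
  exact key N 0 s (by omega) h0 (by simpa using hc)

@[simp] theorem State.setReg_reg (s : State) (i x : ℕ) :
    (s.setReg i x).reg = Function.update s.reg i x := rfl

@[simp] theorem State.setReg_arr (s : State) (i x : ℕ) : (s.setReg i x).arr = s.arr := rfl

/-- The final state `s'` of an evaluation of an expression at level `d`: everything but scratch
space is as in `s`, and the result is `x`. -/
def Result (d : ℕ) (s : State) (x : ℕ) (s' : State) : Prop :=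
  s'.reg (2 * d + 1) = x ∧ s'.arr = s.arr ∧ (∀ i, s'.reg (2 * i) = s.reg (2 * i)) ∧
    ∀ i, i < d → s'.reg (2 * i + 1) = s.reg (2 * i + 1)

theorem Expr.exec_comp (e : Expr) : ∀ (d N : ℕ) (s : State), (∀ i, s.env i ≤ N) →
    ∃ t s', Exec (e.comp d) s t s' ∧ t ≤ e.cost.eval N ∧ Result d s (e.eval s.env s.arr) s' := by
  induction e with
  | var i =>
    intro d N s _
    refine ⟨_, _, .seq (.const _ _ _) (.plus _ _ _ _), by simp [cost], ?_⟩
    refine ⟨?_, rfl, fun j => ?_, fun j hj => ?_⟩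
    · simp [Function.update_apply, eval, State.env]
      intro h; omega
    · simp only [State.setReg_reg, Function.update_apply]
      split_ifs <;> omega
    · simp only [State.setReg_reg, Function.update_apply]
      split_ifs <;> omega
  | num c =>
    intro d N s _
    refine ⟨_, _, .const _ _ _, by simp [cost], ?_⟩
    refine ⟨by simp [eval], rfl, fun j => ?_, fun j hj => ?_⟩
    · simp only [State.setReg_reg, Function.update_apply]
      split_ifs <;> omega
    · simp only [State.setReg_reg, Function.update_apply]
      split_ifs <;> omega
  | add e f ihe ihf =>
    intro d N s hN
    obtain ⟨t, s', he, ht, h1, h2, h3, h4⟩ := ihe d N s hN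
    have henv : s'.env = s.env := funext fun i => h3 i
    obtain ⟨t', s'', he', ht', h1', h2', h3', h4'⟩ := ihf (d + 1) N s' (by rwa [henv])
    refine ⟨_, _, .seq he (.seq he' (.plus _ _ _ _)), ?_, ?_⟩
    · simp only [cost, Polynomial.eval_add, Polynomial.eval_one]; omega
    refine ⟨?_, by simp [h2, h2'], fun j => ?_, fun j hj => ?_⟩
    · have := h4' d (by omega)
      simp [eval, h1', this, h1, henv, h2]
    · rw [State.setReg_reg, Function.update_of_ne (by omega), h3', h3]
    · rw [State.setReg_reg, Function.update_of_ne (by omega), h4' j (by omega), h4 j hj]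
  | sub e f ihe ihf =>
    intro d N s hN
    obtain ⟨t, s', he, ht, h1, h2, h3, h4⟩ := ihe d N s hN
    have henv : s'.env = s.env := funext fun i => h3 i
    obtain ⟨t', s'', he', ht', h1', h2', h3', h4'⟩ := ihf (d + 1) N s' (by rwa [henv])
    refine ⟨_, _, .seq he (.seq he' (.monus _ _ _ _)), ?_, ?_⟩
    · simp only [cost, Polynomial.eval_add, Polynomial.eval_one]; omega
    refine ⟨?_, by simp [h2, h2'], fun j => ?_, fun j hj => ?_⟩
    · have := h4' d (by omega)
      simp [eval, h1', this, h1, henv, h2]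
    · rw [State.setReg_reg, Function.update_of_ne (by omega), h3', h3]
    · rw [State.setReg_reg, Function.update_of_ne (by omega), h4' j (by omega), h4 j hj]
  | get a e ihe =>
    intro d N s hN
    obtain ⟨t, s', he, ht, h1, h2, h3, h4⟩ := ihe d N s hN
    refine ⟨_, _, .seq he (.load _ _ _ _), ?_, ?_⟩
    · simp only [cost, Polynomial.eval_add, Polynomial.eval_one]; omega
    refine ⟨by simp [eval, h1, h2], by simp [h2], fun j => ?_, fun j hj => ?_⟩
    · rw [State.setReg_reg, Function.update_of_ne (by omega), h3]
    · rw [State.setReg_reg, Function.update_of_ne (by omega), h4 j hj]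
  | mulv e b ihe =>
    intro d N s hN
    obtain ⟨t, s', he, ht, h1, h2, h3, h4⟩ := ihe d N s hN
    set x := e.eval s.env s.arr with hx
    obtain ⟨t', s'', he', ht', ⟨h0', h1', h2', h3', h4', h5'⟩, hc⟩ :=
      exec_countdown (c := 2 * d + 5) (N := s.env b) (C := 2)
        (body := .seq (.plus (2 * d + 3) (2 * d + 3) (2 * d + 1))
          (.monus (2 * d + 5) (2 * d + 5) (2 * d + 7)))
        (fun j u => u.reg (2 * d + 7) = 1 ∧ u.reg (2 * d + 1) = x ∧ u.reg (2 * d + 3) = x * j ∧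
          u.arr = s.arr ∧ (∀ i, u.reg (2 * i) = s.reg (2 * i)) ∧
          ∀ i, i < d → u.reg (2 * i + 1) = s.reg (2 * i + 1))
        (by
          rintro j u hj ⟨g0, g1, g2, g3, g4, g5⟩ gc
          refine ⟨_, _, .seq (.plus _ _ _ _) (.monus _ _ _ _), le_rfl, ⟨?_, ?_, ?_, g3, ?_, ?_⟩, ?_⟩
          · simp [g0]
          · simp [g1]
          · simp [g1, g2]; ring
          · intro i
            simp only [State.setReg_reg, Function.update_apply]
            split_ifs <;> first | omega | exact g4 i
          · intro i hi
            simp only [State.setReg_reg, Function.update_apply]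
            split_ifs <;> first | omega | exact g5 i hi
          · simp [g0, gc]; omega)
        (s := (((s'.setReg (2 * d + 3) 0).setReg (2 * d + 5) 0).setReg (2 * d + 5) (s.env b)).setReg
          (2 * d + 7) 1)
        (by
          refine ⟨by simp, ?_, ?_, by simp [h2], ?_, ?_⟩
          · simp [h1]
          · simp
          · intro i
            simp only [State.setReg_reg, Function.update_apply]
            split_ifs <;> first | omega | exact h3 i
          · intro i hi
            simp only [State.setReg_reg, Function.update_apply]
            split_ifs <;> first | omega | exact h4 i hi)
        (by simp)
    have hplus : Exec (.plus (2 * d + 5) (2 * b) (2 * d + 5))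
        ((s'.setReg (2 * d + 3) 0).setReg (2 * d + 5) 0) 1
        (((s'.setReg (2 * d + 3) 0).setReg (2 * d + 5) 0).setReg (2 * d + 5) (s.env b)) := by
      have := Exec.plus ((s'.setReg (2 * d + 3) 0).setReg (2 * d + 5) 0) (2 * d + 5) (2 * b)
        (2 * d + 5)
      convert this using 2
      simp only [State.setReg_reg, Function.update_apply, State.env, ← h3 b]
      split_ifs <;> omega
    refine ⟨_, _, .seq he (.seq (.const _ _ _) (.seq (.const _ _ _) (.seq hplus
      (.seq (.const _ _ _) (.seq he' (.plus _ _ _ _)))))), ?_, ?_⟩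
    · have := Nat.mul_le_mul_right 3 (hN b)
      simp [cost]; omega
    · refine ⟨by simp [h2', hc, eval, hx], by simpa using h3', fun j => ?_, fun j hj => ?_⟩
      · rw [State.setReg_reg, Function.update_of_ne (by omega), h4']
      · rw [State.setReg_reg, Function.update_of_ne (by omega), h5' j hj]
  | sum i b e ihe =>
    intro d N s hN
    set f : ℕ → ℕ := fun x => e.eval (Function.update s.env i x) s.arr with hf
    set C := e.cost.eval N with hC
    obtain ⟨t', s'', he', ht', ⟨h0', h1', h2', h3', h4', h5'⟩, hc⟩ :=
      exec_countdown (c := 2 * d + 5) (N := s.env b) (C := C + 3)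
        (body := (.seq (e.comp (d + 4))
          (.seq (.plus (2 * d + 1) (2 * d + 1) (2 * (d + 4) + 1))
          (.seq (.plus (2 * i) (2 * i) (2 * d + 7)) (.monus (2 * d + 5) (2 * d + 5) (2 * d + 7))))))
        (fun j u => u.reg (2 * d + 7) = 1 ∧ u.reg (2 * d + 1) = ∑ x ∈ Finset.range j, f x ∧
          u.reg (2 * d + 3) = s.reg (2 * i) ∧
          u.arr = s.arr ∧ u.env = Function.update s.env i j ∧
          ∀ i, i < d → u.reg (2 * i + 1) = s.reg (2 * i + 1))
        (by
          rintro j u hj ⟨g0, g1, g2, g3, g4, g5⟩ gc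
          obtain ⟨t, v, he, ht, k1, k2, k3, k4⟩ := ihe (d + 4) N u (by
            intro l
            rw [g4, Function.update_apply]
            have := hN b
            split_ifs
            · omega
            · exact hN l)
          have e0 := k4 (d + 3) (by omega)
          have e1 := k4 d (by omega)
          have e2 := k4 (d + 1) (by omega)
          have e3 := k4 (d + 2) (by omega)
          rw [show 2 * (d + 3) + 1 = 2 * d + 7 by ring] at e0
          rw [show 2 * (d + 1) + 1 = 2 * d + 3 by ring] at e2
          rw [show 2 * (d + 2) + 1 = 2 * d + 5 by ring] at e3
          rw [show 2 * (d + 4) + 1 = 2 * d + 9 by ring] at k1 ⊢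
          refine ⟨_, _, .seq he (.seq (.plus _ _ _ _) (.seq (.plus _ _ _ _) (.monus _ _ _ _))),
            by omega, ⟨?_, ?_, ?_, ?_, ?_, ?_⟩, ?_⟩
          · simp only [State.setReg_reg, Function.update_apply]
            split_ifs <;> omega
          · simp only [State.setReg_reg, Function.update_apply]
            rw [if_neg (by omega), if_neg (by omega), if_pos trivial, k1, e1, g1, g3, g4,
              Finset.sum_range_succ]
          · simp only [State.setReg_reg, Function.update_apply]
            split_ifs <;> omega
          · simpa [k2] using g3
          · funext l
            have hl : u.reg (2 * l) = Function.update s.env i j l := by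
              rw [← g4]; rfl
            have hi : u.reg (2 * i) = Function.update s.env i j i := by
              rw [← g4]; rfl
            simp only [State.setReg_reg, Function.update_apply, State.env] at hl hi ⊢
            rw [if_neg (by omega)]
            by_cases hli : l = i
            · subst hli
              rw [if_pos rfl, if_pos rfl, if_neg (by omega), if_neg (by omega), k3, hl, if_pos rfl,
                e0, g0]
            · rw [if_neg (by omega), if_neg hli, if_neg (by omega), k3, hl, if_neg hli]
          · intro l hl
            have := k4 l (by omega)
            simp only [State.setReg_reg, Function.update_apply]
            split_ifs <;> first | omega | (rw [this]; exact g5 l hl)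
          · simp only [State.setReg_reg, Function.update_apply]
            rw [if_pos trivial, if_neg (by omega), if_neg (by omega), if_neg (by omega),
              if_neg (by omega), e0, g0, e3, gc]
            omega)
        (s := ((((s.setReg (2 * d + 1) 0).setReg (2 * d + 3) (s.env i)).setReg (2 * d + 5)
          (s.env b)).setReg (2 * d + 7) 1).setReg (2 * i) 0)
        (by
          refine ⟨?_, ?_, ?_, rfl, ?_, ?_⟩
          · simp only [State.setReg_reg, Function.update_apply]
            split_ifs <;> omega
          · simp only [State.setReg_reg, Function.update_apply]
            rw [if_neg (by omega), if_neg (by omega), if_neg (by omega), if_neg (by omega),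
              if_pos trivial]
            rfl
          · simp only [State.setReg_reg, Function.update_apply]
            rw [if_neg (by omega), if_neg (by omega), if_neg (by omega), if_pos trivial]
            rfl
          · funext l
            simp only [State.setReg_reg, Function.update_apply, State.env]
            split_ifs <;> omega
          · intro l hl
            simp only [State.setReg_reg, Function.update_apply]
            split_ifs <;> omega)
        (by
          simp only [State.setReg_reg, Function.update_apply]
          split_ifs <;> omega)
    have hplus1 : Exec (.plus (2 * d + 3) (2 * i) (2 * d + 1)) (s.setReg (2 * d + 1) 0) 1
        ((s.setReg (2 * d + 1) 0).setReg (2 * d + 3) (s.env i)) := by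
      have := Exec.plus (s.setReg (2 * d + 1) 0) (2 * d + 3) (2 * i) (2 * d + 1)
      convert this using 2
      simp only [State.setReg_reg, Function.update_apply, State.env]
      split_ifs <;> omega
    have hplus2 : Exec (.plus (2 * d + 5) (2 * b) (2 * d + 1))
        ((s.setReg (2 * d + 1) 0).setReg (2 * d + 3) (s.env i)) 1
        (((s.setReg (2 * d + 1) 0).setReg (2 * d + 3) (s.env i)).setReg (2 * d + 5)
          (s.env b)) := by
      have := Exec.plus ((s.setReg (2 * d + 1) 0).setReg (2 * d + 3) (s.env i)) (2 * d + 5) (2 * b)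
        (2 * d + 1)
      convert this using 2
      simp only [State.setReg_reg, Function.update_apply, State.env]
      split_ifs <;> omega
    refine ⟨_, _, .seq (.const _ _ _) (.seq hplus1 (.seq hplus2
      (.seq (.const _ _ _) (.seq (.const _ _ _) (.seq he' (.plus _ _ _ _)))))), ?_, ?_⟩
    · have := Nat.mul_le_mul_right (C + 3 + 1) (hN b)
      have hc4 : C + 3 + 1 = C + 4 := rfl
      rw [hc4] at this ht'
      simp only [cost, Polynomial.eval_add, Polynomial.eval_mul, Polynomial.eval_X,
        Polynomial.eval_ofNat, ← hC]
      omega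
    · refine ⟨?_, by simpa using h3', fun j => ?_, fun j hj => ?_⟩
      · rw [State.setReg_reg, Function.update_of_ne (by omega), h1']; rfl
      · have hj : s''.reg (2 * j) = Function.update s.env i (s.env b) j := by rw [← h4']; rfl
        rw [State.setReg_reg]
        by_cases hji : j = i
        · subst hji
          rw [Function.update_self, h2', hc, Nat.add_zero]
        · rw [Function.update_of_ne (by omega), hj, Function.update_of_ne hji]; rfl
      · rw [State.setReg_reg, Function.update_of_ne (by omega), h5' j hj]

end RAM

/-! ### Assignments and tables -/

namespace RAM

/-- The program `x_j := e`. -/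
def assign (j : ℕ) (e : Expr) : Prog :=
  .seq (e.comp 0) (.seq (.const 3 0) (.plus (2 * j) 1 3))

/-- A bound for the number of steps of `assign j e`. -/
noncomputable def assignCost (e : Expr) : Polynomial ℕ := e.cost + 2

theorem exec_assign (j : ℕ) (e : Expr) (N : ℕ) (s : State) (hN : ∀ i, s.env i ≤ N) :
    ∃ t s', Exec (assign j e) s t s' ∧ t ≤ (assignCost e).eval N ∧
      s'.env = Function.update s.env j (e.eval s.env s.arr) ∧ s'.arr = s.arr := by
  obtain ⟨t, s', he, ht, h1, h2, h3, -⟩ := e.exec_comp 0 N s hN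
  refine ⟨_, _, .seq he (.seq (.const _ _ _) (.plus _ _ _ _)), ?_, ?_, by simpa using h2⟩
  · simp only [assignCost, Polynomial.eval_add, Polynomial.eval_ofNat]; omega
  · funext l
    have := h3 l
    simp only [State.env, State.setReg_reg, Function.update_apply] at *
    by_cases hl : l = j
    · subst hl
      simpa using h1
    · rw [if_neg (by omega), if_neg (by omega), if_neg hl, this]

/-- The program that fills the array `A_a` with `A_a[x_i] := e` for `x_i = 0, …, x_b - 1`, in this
order. -/
def tab (a i b : ℕ) (e : Expr) : Prog :=
  .seq (.const 1 0) (.seq (.plus 3 (2 * b) 1) (.seq (.const 5 1) (.seq (.const (2 * i) 0)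
    (.seq (.loop 3 (.seq (e.comp 3) (.seq (.store a (2 * i) 7)
        (.seq (.plus (2 * i) (2 * i) 5) (.monus 3 3 5)))))
      (.const (2 * i) 0)))))

/-- A bound for the number of steps of `tab a i b e`. -/
noncomputable def tabCost (e : Expr) : Polynomial ℕ := Polynomial.X * (e.cost + 4) + 6

/-- The contents of the arrays, where the cells of `A_a` from `x` on are cleared. -/
def cut (A : ℕ → ℕ → ℕ) (a x : ℕ) : ℕ → ℕ → ℕ := fun b y => if b = a ∧ x ≤ y then 0 else A b y

/-- If `A_a` is empty at the start, then `tab a i b e` solves the recursion that determines the cell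
`A_a[x]` by `e` from the cells `A_a[y]` with `y < x`. -/
theorem exec_tab (a i b : ℕ) (e : Expr) (N : ℕ) (s : State) (hN : ∀ l, s.env l ≤ N)
    (hi : s.env i = 0) (ha : ∀ x, s.arr a x = 0) :
    ∃ t s', Exec (tab a i b e) s t s' ∧
      t ≤ (tabCost e).eval N ∧ s'.env = s.env ∧
      (∀ c, c ≠ a → s'.arr c = s.arr c) ∧
      ∀ x < s.env b, s'.arr a x = e.eval (Function.update s.env i x) (cut s'.arr a x) := by
  obtain ⟨t', s'', he', ht', ⟨h1, h2, h3, h4, h5⟩, hc⟩ :=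
    exec_countdown (c := 3) (N := s.env b) (C := e.cost.eval N + 3)
      (body := .seq (e.comp 3) (.seq (.store a (2 * i) 7)
        (.seq (.plus (2 * i) (2 * i) 5) (.monus 3 3 5))))
      (fun j u => u.reg 5 = 1 ∧ u.env = Function.update s.env i j ∧
        (∀ c, c ≠ a → u.arr c = s.arr c) ∧
        (∀ x < j, u.arr a x = e.eval (Function.update s.env i x) (cut u.arr a x)) ∧
        ∀ x, j ≤ x → u.arr a x = 0)
      (by
        rintro j u hj ⟨g1, g2, g3, g4, g5⟩ gc
        obtain ⟨t, v, he, ht, k1, k2, k3, k4⟩ := e.exec_comp 3 N u (by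
          intro l
          rw [g2, Function.update_apply]
          have := hN b
          split_ifs
          · omega
          · exact hN l)
        have e1 : v.reg 3 = u.reg 3 := k4 1 (by omega)
        have e2 : v.reg 5 = u.reg 5 := k4 2 (by omega)
        have e3 : v.reg (2 * i) = j := by
          rw [k3]
          change u.env i = j
          rw [g2, Function.update_self]
        have e4 : ∀ l, l ≠ i → v.reg (2 * l) = s.env l := by
          intro l hl
          rw [k3]
          change u.env l = _
          rw [g2, Function.update_of_ne hl]
        have e5 : ∀ x ≤ j, cut (Function.update u.arr a (Function.update (u.arr a) j
            (v.reg 7))) a x = cut u.arr a x := by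
          intro x hx
          funext c y
          simp only [cut]
          split_ifs with p
          · rfl
          · by_cases hc : c = a
            · subst hc
              have : ¬ x ≤ y := fun h => p ⟨rfl, h⟩
              rw [Function.update_self, Function.update_of_ne (by omega)]
            · rw [Function.update_of_ne hc]
        have e6 : cut u.arr a j = u.arr := by
          funext c y
          simp only [cut]
          split_ifs with p1
          · rw [p1.1, g5 y p1.2]
          · rfl
        have k1' : v.reg 7 = e.eval u.env u.arr := k1
        refine ⟨_, _, .seq he (.seq (.store _ _ _ _) (.seq (.plus _ _ _ _) (.monus _ _ _ _))),
          by omega, ⟨?_, ?_, ?_, ?_, ?_⟩, ?_⟩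
        · simp only [State.setReg_reg, State.setArr, Function.update_apply]
          split_ifs <;> omega
        · funext l
          simp only [State.env, State.setReg_reg, State.setArr, Function.update_apply]
          by_cases hl : l = i
          · subst hl
            rw [if_neg (by omega), if_pos rfl, if_pos rfl, e3, e2, g1]
          · rw [if_neg (by omega), if_neg (by omega), if_neg hl, e4 l hl]
            rfl
        · intro c hc
          simp only [State.setReg_arr, State.setArr, k2]
          rw [Function.update_of_ne hc, g3 c hc]
        · intro x hx
          simp only [State.setReg_arr, State.setArr, k2, e3]
          rw [e5 x (by omega), Function.update_self]
          by_cases hxj : x = j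
          · subst hxj
            rw [Function.update_self, k1', e6, g2]
          · rw [Function.update_of_ne hxj, g4 x (by omega)]
        · intro x hx
          simp only [State.setReg_arr, State.setArr, k2, e3]
          rw [Function.update_self, Function.update_of_ne (by omega), g5 x (by omega)]
        · simp only [State.setReg_reg, State.setArr, Function.update_apply]
          rw [if_pos trivial, if_neg (by omega), if_neg (by omega), e1, e2, g1, gc]
          omega)
      (s := (((s.setReg 1 0).setReg 3 (s.env b)).setReg 5 1).setReg (2 * i) 0)
      (by
        refine ⟨?_, ?_, fun _ _ => rfl, by simp, fun x _ => ha x⟩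
        · simp only [State.setReg_reg, Function.update_apply]
          split_ifs <;> omega
        · funext l
          simp only [State.env, State.setReg_reg, Function.update_apply]
          split_ifs <;> omega)
      (by
        simp only [State.setReg_reg, Function.update_apply]
        split_ifs <;> omega)
  have hplus : Exec (.plus 3 (2 * b) 1) (s.setReg 1 0) 1
      ((s.setReg 1 0).setReg 3 (s.env b)) := by
    have := Exec.plus (s.setReg 1 0) 3 (2 * b) 1
    convert this using 2
    simp only [State.setReg_reg, Function.update_apply, State.env]
    split_ifs <;> omega
  refine ⟨_, _, .seq (.const _ _ _) (.seq hplus (.seq (.const _ _ _) (.seq (.const _ _ _)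
    (.seq he' (.const _ _ _))))), ?_, ?_, ?_, ?_⟩
  · have := Nat.mul_le_mul_right (e.cost.eval N + 3 + 1) (hN b)
    have hc4 : e.cost.eval N + 3 + 1 = e.cost.eval N + 4 := rfl
    rw [hc4] at this ht'
    simp only [tabCost, Polynomial.eval_add, Polynomial.eval_mul, Polynomial.eval_X,
      Polynomial.eval_ofNat]
    omega
  · funext l
    have hl : s''.reg (2 * l) = Function.update s.env i (s.env b) l := by rw [← h2]; rfl
    simp only [State.env, State.setReg_reg, Function.update_apply] at hl hi ⊢
    by_cases hli : l = i
    · subst hli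
      rw [if_pos rfl, hi]
    · rw [if_neg (by omega), hl, if_neg hli]
  · simpa using h3
  · simpa using h4

/-! ### Formulas -/

namespace Expr

/-- An expression, read as a formula, holds if its value is not `0`. -/
def Holds (e : Expr) (ρ : ℕ → ℕ) (A : ℕ → ℕ → ℕ) : Prop := e.eval ρ A ≠ 0

/-- Negation. Its value is `0` or `1`. -/
def not (e : Expr) : Expr := sub (num 1) e
/-- Conjunction. -/
def and (e f : Expr) : Expr := not (add (not e) (not f))
/-- Disjunction. -/
def or (e f : Expr) : Expr := add e f
/-- Equality. -/
def eq (e f : Expr) : Expr := not (add (sub e f) (sub f e))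
/-- The strict order. -/
def lt (e f : Expr) : Expr := sub f e
/-- `ex i b e` is `∃ xᵢ < x_b, e`. -/
def ex (i b : ℕ) (e : Expr) : Expr := sum i b e
/-- `all i b e` is `∀ xᵢ < x_b, e`. -/
def all (i b : ℕ) (e : Expr) : Expr := not (ex i b (not e))
/-- Implication. -/
def imp (e f : Expr) : Expr := or (not e) f
/-- Equivalence. -/
def iff (e f : Expr) : Expr := and (imp e f) (imp f e)

variable (e f : Expr) (ρ : ℕ → ℕ) (A : ℕ → ℕ → ℕ) (i b a : ℕ)

open Classical in
theorem eval_not : (not e).eval ρ A = if e.Holds ρ A then 0 else 1 := by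
  by_cases h : e.eval ρ A = 0
  · simp [not, eval, Holds, h]
  · simp only [not, eval, Holds, ne_eq, h, not_false_eq_true, if_true]
    omega

theorem holds_not : (not e).Holds ρ A ↔ ¬ e.Holds ρ A := by
  simp only [not, eval, Holds]; omega

theorem holds_or : (or e f).Holds ρ A ↔ e.Holds ρ A ∨ f.Holds ρ A := by
  simp only [or, eval, Holds]; omega

theorem holds_and : (and e f).Holds ρ A ↔ e.Holds ρ A ∧ f.Holds ρ A := by
  simp only [and, not, eval, Holds]; omega

theorem holds_eq : (eq e f).Holds ρ A ↔ e.eval ρ A = f.eval ρ A := by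
  simp only [eq, not, eval, Holds]; omega

theorem holds_lt : (lt e f).Holds ρ A ↔ e.eval ρ A < f.eval ρ A := by
  simp only [lt, eval, Holds]; omega

theorem holds_ex :
    (ex i b e).Holds ρ A ↔ ∃ x < ρ b, e.Holds (Function.update ρ i x) A := by
  simp [ex, eval, Holds]

theorem holds_all :
    (all i b e).Holds ρ A ↔ ∀ x < ρ b, e.Holds (Function.update ρ i x) A := by
  simp [all, holds_not, holds_ex]

open Classical in
theorem eval_all : (all i b e).eval ρ A =
    if ∀ x < ρ b, e.Holds (Function.update ρ i x) A then 1 else 0 := by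
  rw [all, eval_not, holds_ex]
  simp only [holds_not]
  by_cases h : ∀ x < ρ b, e.Holds (Function.update ρ i x) A
  · rw [if_pos h, if_neg fun ⟨x, hx, hn⟩ => hn (h x hx)]
  · rw [if_neg h, if_pos]
    by_contra hn
    exact h fun x hx => by_contra fun hx' => hn ⟨x, hx, hx'⟩

theorem holds_imp : (imp e f).Holds ρ A ↔ (e.Holds ρ A → f.Holds ρ A) := by
  rw [imp, holds_or, holds_not]; tauto

theorem holds_iff : (iff e f).Holds ρ A ↔ (e.Holds ρ A ↔ f.Holds ρ A) := by
  rw [iff, holds_and, holds_imp, holds_imp]; tauto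

theorem holds_get : (get a e).Holds ρ A ↔ A a (e.eval ρ A) ≠ 0 := Iff.rfl

end Expr

end RAM

/-! ### Simplicial vertices of chordal graphs -/

namespace SimpleGraph.Walk

variable {V : Type*} {G : SimpleGraph V}

theorem edge_getVert_succ_mem_edges {u v : V} (p : G.Walk u v) :
    ∀ i < p.length, s(p.getVert i, p.getVert (i + 1)) ∈ p.edges := by
  induction p with
  | nil => intro i hi; simp at hi
  | cons h p ih =>
    intro i hi
    cases i with
    | zero => simp
    | succ i =>
      simp only [length_cons, Nat.add_lt_add_iff_right] at hi
      simp only [getVert_cons_succ, edges_cons, List.mem_cons]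
      exact Or.inr (ih i hi)

/-- A chord of a walk yields a shorter walk inside the same set of vertices. -/
theorem exists_shorter_of_chord {u v x y : V} (p : G.Walk u v) (hx : x ∈ p.support)
    (hy : y ∈ p.support) (h : G.Adj x y) (he : s(x, y) ∉ p.edges) :
    ∃ q : G.Walk u v, q.length < p.length ∧ q.support ⊆ p.support := by
  have key : ∀ i j, i < j → j ≤ p.length → G.Adj (p.getVert i) (p.getVert j) →
      s(p.getVert i, p.getVert j) ∉ p.edges →
      ∃ q : G.Walk u v, q.length < p.length ∧ q.support ⊆ p.support := by
    intro i j hij hj hadj hne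
    have hj' : j ≠ i + 1 := by
      rintro rfl
      exact hne (p.edge_getVert_succ_mem_edges i (by omega))
    refine ⟨(p.take i).append (cons hadj (p.drop j)), ?_, ?_⟩
    · rw [length_append, length_cons, take_length, drop_length]
      omega
    · intro w hw
      rw [mem_support_append_iff, support_cons, List.mem_cons] at hw
      rcases hw with hw | rfl | hw
      · exact (p.isSubwalk_take i).support_subset hw
      · exact p.getVert_mem_support i
      · exact (p.isSubwalk_drop j).support_subset hw
  obtain ⟨i, rfl, hi⟩ := mem_support_iff_exists_getVert.mp hx
  obtain ⟨j, rfl, hj⟩ := mem_support_iff_exists_getVert.mp hy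
  rcases lt_trichotomy i j with hij | rfl | hij
  · exact key i j hij hj h he
  · exact absurd h (G.irrefl)
  · exact key j i hij hi h.symm (by rwa [Sym2.eq_swap])

end SimpleGraph.Walk

section Chordal

variable {V : Type*} {G : SimpleGraph V}

/-- In a chordal graph, let `r` be a vertex without neighbours in a connected set `C`. Then any two
neighbours of `r` that have neighbours in `C` are adjacent: otherwise, a shortest path between them
through `C` together with `r` is a cycle without a chord. -/
theorem IsChordal.adj_of_connected (hG : IsChordal G) {C : Set V}
    (hC : ∀ a ∈ C, ∀ b ∈ C, ∃ p : G.Walk a b, ∀ x ∈ p.support, x ∈ C) {s s' r a b : V}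
    (ha : a ∈ C) (hb : b ∈ C) (hsa : G.Adj s a) (hsb : G.Adj s' b) (hrs : G.Adj r s)
    (hrs' : G.Adj r s') (hr : r ∉ C) (hrC : ∀ c ∈ C, ¬ G.Adj r c) (hss : s ≠ s') :
    G.Adj s s' := by
  classical
  by_contra hadj
  have hex : ∃ k, ∃ p : G.Walk s s', (∀ x ∈ p.support, x ∈ C ∨ x = s ∨ x = s') ∧ p.length = k := by
    obtain ⟨p, hp⟩ := hC a ha b hb
    refine ⟨_, .cons hsa (p.concat hsb.symm), ?_, rfl⟩
    intro x hx
    rw [SimpleGraph.Walk.support_cons, List.mem_cons, SimpleGraph.Walk.support_concat] at hx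
    simp only [List.mem_append, List.mem_singleton] at hx
    rcases hx with hx | hx | hx
    · exact Or.inr (Or.inl hx)
    · exact Or.inl (hp x hx)
    · exact Or.inr (Or.inr hx)
  obtain ⟨p₀, hp₀, hlen₀⟩ := Nat.find_spec hex
  have hmin : ∀ q : G.Walk s s', (∀ x ∈ q.support, x ∈ C ∨ x = s ∨ x = s') →
      p₀.length ≤ q.length := by
    intro q hq
    rw [hlen₀]
    exact Nat.find_min' hex ⟨q, hq, rfl⟩
  have hpath : p₀.IsPath := by
    have h1 := hmin p₀.bypass (fun x hx => hp₀ x (p₀.support_bypass_subset_support hx))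
    rw [← p₀.bypass_eq_self_of_length_le_length_bypass h1]
    exact p₀.bypass_isPath
  have hlen : 2 ≤ p₀.length := by
    by_contra hlt
    have h01 : p₀.length = 0 ∨ p₀.length = 1 := by omega
    rcases h01 with h0 | h1
    · exact hss (SimpleGraph.Walk.eq_of_length_eq_zero h0)
    · exact hadj (SimpleGraph.Walk.adj_of_length_eq_one h1)
  have hrp : r ∉ p₀.support := by
    intro h
    rcases hp₀ r h with h | h | h
    · exact hr h
    · exact hrs.ne h
    · exact hrs'.ne h
  have hcyc : (SimpleGraph.Walk.cons hrs (p₀.concat hrs'.symm)).IsCycle := by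
    rw [SimpleGraph.Walk.cons_isCycle_iff]
    refine ⟨hpath.concat hrp _, ?_⟩
    rw [SimpleGraph.Walk.edges_concat]
    simp only [List.concat_eq_append, List.mem_append, List.mem_singleton, not_or]
    refine ⟨fun h => hrp (p₀.fst_mem_support_of_mem_edges h), ?_⟩
    intro h
    rw [Sym2.eq_iff] at h
    rcases h with ⟨h, -⟩ | ⟨-, h⟩
    · exact hrs'.ne h
    · exact hss h
  obtain ⟨x, hx, y, hy, hxy, hne⟩ := hG r _ hcyc (by
    simp only [SimpleGraph.Walk.length_cons, SimpleGraph.Walk.length_concat]; omega)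
  simp only [SimpleGraph.Walk.support_cons, SimpleGraph.Walk.support_concat, List.mem_cons,
    List.concat_eq_append, List.mem_append, List.not_mem_nil, or_false,
    SimpleGraph.Walk.edges_cons, SimpleGraph.Walk.edges_concat, not_or] at hx hy hne
  have hr_nbr : ∀ z, z ∈ p₀.support → G.Adj r z → z = s ∨ z = s' := by
    intro z hz hrz
    rcases hp₀ z hz with h | h
    · exact absurd hrz (hrC z h)
    · exact h
  obtain ⟨hne1, hne2, hne3⟩ := hne
  have hx' : x = r ∨ x ∈ p₀.support := by tauto
  have hy' : y = r ∨ y ∈ p₀.support := by tauto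
  rcases hx' with rfl | hx'
  · rcases hy' with rfl | hy'
    · exact G.irrefl hxy
    · rcases hr_nbr y hy' hxy with rfl | rfl
      · exact hne1 rfl
      · exact hne3 (Sym2.eq_swap)
  · rcases hy' with rfl | hy'
    · rcases hr_nbr x hx' hxy.symm with rfl | rfl
      · exact hne1 (Sym2.eq_swap)
      · exact hne3 rfl
    · obtain ⟨q, hq, hqs⟩ := p₀.exists_shorter_of_chord hx' hy' hxy hne2
      exact absurd (hmin q fun z hz => hp₀ z (hqs hz)) (by omega)

/-- Every nonempty induced subgraph of a finite chordal graph has a simplicial vertex. In a set `W`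
that is not a clique, let `C` be a maximal connected set with a nonempty set `R` of vertices that
are neither in `C` nor neighbours of `C`. By maximality, every neighbour of `C` is adjacent to all
of `R`, and so the neighbours of `C` form a clique. Hence, a simplicial vertex of `R` is simplicial
in `W`. -/
theorem IsChordal.exists_simplicial (hG : IsChordal G) (W : Finset V) (hW : W.Nonempty) :
    ∃ v ∈ W, ∀ x ∈ W, ∀ y ∈ W, G.Adj v x → G.Adj v y → x ≠ y → G.Adj x y := by
  classical
  induction W using Finset.strongInduction with
  | H W ih =>
  by_cases hcl : ∀ x ∈ W, ∀ y ∈ W, x ≠ y → G.Adj x y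
  · obtain ⟨v, hv⟩ := hW
    exact ⟨v, hv, fun x hx y hy _ _ hxy => hcl x hx y hy hxy⟩
  push Not at hcl
  obtain ⟨a, haW, b, hbW, hab, hnab⟩ := hcl
  let far : Finset V → Finset V := fun C => W.filter fun z => z ∉ C ∧ ∀ c ∈ C, ¬ G.Adj c z
  let good : Finset V → Prop := fun C => C.Nonempty ∧ (far C).Nonempty ∧
    ∀ x ∈ C, ∀ y ∈ C, ∃ p : G.Walk x y, ∀ z ∈ p.support, z ∈ C
  have hgood : good {a} := by
    refine ⟨Finset.singleton_nonempty a, ⟨b, ?_⟩, ?_⟩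
    · simp [far, hbW, hab.symm, hnab]
    · intro x hx y hy
      rw [Finset.mem_singleton] at hx hy
      subst hx; subst hy
      exact ⟨.nil, by simp⟩
  obtain ⟨C, hCW, hC⟩ : ∃ C ∈ W.powerset, good C ∧ ∀ C' ∈ W.powerset, good C' →
      C'.card ≤ C.card := by
    obtain ⟨C, hC, hmax⟩ := Finset.exists_max_image (W.powerset.filter good) Finset.card
      ⟨{a}, by simp [haW, hgood]⟩
    rw [Finset.mem_filter] at hC
    exact ⟨C, hC.1, hC.2, fun C' h1 h2 => hmax C' (Finset.mem_filter.mpr ⟨h1, h2⟩)⟩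
  obtain ⟨⟨⟨c₀, hc₀⟩, hfar, hconn⟩, hmax⟩ := hC
  rw [Finset.mem_powerset] at hCW
  -- A neighbour of `C` that misses a vertex of `R` could be added to `C`.
  have hcomplete : ∀ s ∈ W, s ∉ C → (∃ c ∈ C, G.Adj c s) → ∀ z ∈ far C, G.Adj s z := by
    rintro s hsW hsC ⟨c, hc, hcs⟩ z hz
    by_contra hsz
    simp only [far, Finset.mem_filter] at hz
    have hg : good (insert s C) := by
      refine ⟨Finset.insert_nonempty _ _, ⟨z, ?_⟩, ?_⟩
      · simp only [far, Finset.mem_filter, Finset.mem_insert, not_or]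
        refine ⟨hz.1, ⟨?_, hz.2.1⟩, ?_⟩
        · rintro rfl
          exact hz.2.2 c hc hcs
        · rintro d (rfl | hd)
          · exact hsz
          · exact hz.2.2 d hd
      · have hto : ∀ x ∈ C, ∃ p : G.Walk x s, ∀ w ∈ p.support, w ∈ insert s C := by
          intro x hx
          obtain ⟨p, hp⟩ := hconn x hx c hc
          refine ⟨p.concat hcs, fun w hw => ?_⟩
          rw [SimpleGraph.Walk.support_concat] at hw
          simp only [List.mem_append, List.mem_singleton] at hw
          rw [Finset.mem_insert]
          exact hw.symm.imp id (hp w)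
        intro x hx y hy
        rw [Finset.mem_insert] at hx hy
        rcases hx with rfl | hx
        · rcases hy with rfl | hy
          · exact ⟨.nil, by simp⟩
          · obtain ⟨p, hp⟩ := hto y hy
            exact ⟨p.reverse, fun w hw => hp w (by simpa using hw)⟩
        · rcases hy with rfl | hy
          · exact hto x hx
          · obtain ⟨p, hp⟩ := hconn x hx y hy
            exact ⟨p, fun w hw => Finset.mem_insert_of_mem (hp w hw)⟩
    have := hmax (insert s C) (by
      rw [Finset.mem_powerset]; exact Finset.insert_subset hsW hCW) hg
    rw [Finset.card_insert_of_notMem hsC] at this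
    omega
  have hsub : far C ⊂ W := by
    refine Finset.ssubset_iff_of_subset (Finset.filter_subset _ _) |>.mpr ⟨c₀, hCW hc₀, ?_⟩
    simp [hc₀]
  obtain ⟨v, hv, hsimp⟩ := ih (far C) hsub hfar
  have hvf := hv
  simp only [far, Finset.mem_filter] at hvf
  have hnbr : ∀ x ∈ W, G.Adj v x → x ∉ far C → x ∉ C ∧ ∃ c ∈ C, G.Adj c x := by
    intro x hx hvx hxf
    have hxC : x ∉ C := fun h => hvf.2.2 x h hvx.symm
    refine ⟨hxC, ?_⟩
    by_contra hno
    push Not at hno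
    exact hxf (by simp only [far, Finset.mem_filter]; exact ⟨hx, hxC, hno⟩)
  refine ⟨v, hvf.1, fun x hx y hy hvx hvy hxy => ?_⟩
  by_cases hxf : x ∈ far C
  · by_cases hyf : y ∈ far C
    · exact hsimp x hxf y hyf hvx hvy hxy
    · obtain ⟨h1, h2⟩ := hnbr y hy hvy hyf
      exact (hcomplete y hy h1 h2 x hxf).symm
  · obtain ⟨h1, c, hc, hcx⟩ := hnbr x hx hvx hxf
    by_cases hyf : y ∈ far C
    · exact hcomplete x hx h1 ⟨c, hc, hcx⟩ y hyf
    · obtain ⟨h1', c', hc', hcy⟩ := hnbr y hy hvy hyf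
      exact hG.adj_of_connected (C := (C : Set V)) hconn hc hc' hcx.symm hcy.symm hvx hvy
        hvf.2.1 (fun d hd h => hvf.2.2 d hd h.symm) hxy

end Chordal

/-! ### Partial matchings -/

/-- The vertex `x` is incident with a pair of `M`. -/
def Covers (M : Finset (ℕ × ℕ)) (x : ℕ) : Prop := ∃ e ∈ M, e.1 = x ∨ e.2 = x

/-- `M` is a matching in the graph `E`, given as a set of pairs `(i, j)` with `i < j`, that is a
partial solution for the set `R` of vertices, where `S` is the set of all vertices outside of `R`
that may be relevant for `R` and that are, or will be, covered. Every edge of `M` has its smaller end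
in `R` and its other end in `R ∪ S`, the set `T` consists of the vertices in `S` that `M` covers, and
every covered vertex of `R` has at most `r` larger neighbours that are covered by `M` or in `S`. -/
structure IsPartial (E : ℕ → ℕ → Prop) (r : ℕ) (R S T : Set ℕ) (M : Finset (ℕ × ℕ)) : Prop where
  edge : ∀ e ∈ M, e.1 < e.2 ∧ E e.1 e.2
  matching : ∀ e ∈ M, ∀ e' ∈ M, ∀ x, (e.1 = x ∨ e.2 = x) → (e'.1 = x ∨ e'.2 = x) → e = e'
  low : ∀ e ∈ M, e.1 ∈ R ∧ (e.2 ∈ R ∨ e.2 ∈ S)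
  touched : ∀ x, x ∈ T ↔ x ∈ S ∧ Covers M x
  deg : ∀ x ∈ R, Covers M x → {y | x < y ∧ E x y ∧ (Covers M y ∨ y ∈ S)}.encard ≤ r

/-- There is a partial solution with `k` edges. -/
def Feasible (E : ℕ → ℕ → Prop) (r : ℕ) (R S T : Set ℕ) (k : ℕ) : Prop :=
  ∃ M, IsPartial E r R S T M ∧ M.card = k

theorem feasible_empty_region {E : ℕ → ℕ → Prop} {r : ℕ} {S T : Set ℕ} {k : ℕ} :
    Feasible E r ∅ S T k ↔ T = ∅ ∧ k = 0 := by
  constructor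
  · rintro ⟨M, hM, rfl⟩
    have h0 : M = ∅ := Finset.eq_empty_of_forall_notMem fun e he => (hM.low e he).1
    subst h0
    refine ⟨Set.eq_empty_of_forall_notMem fun x hx => ?_, rfl⟩
    obtain ⟨-, e, he, -⟩ := (hM.touched x).mp hx
    exact absurd he (Finset.notMem_empty e)
  · rintro ⟨rfl, rfl⟩
    refine ⟨∅, ⟨by simp, by simp, by simp, ?_, by simp⟩, rfl⟩
    simp [Covers]

/-- The relation between a partial solution for `R₁ ∪ R₂ ∪ {v}` and its restrictions to `R₁` and
`R₂`: here, `S₂` is the set of relevant vertices for `R₂`, and `T₁` and `T₂` are the sets of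
vertices covered from `R₁` and from `R₂`. Either `v` is not covered, or it is covered from `R₂`, or
it is matched to a larger vertex `w`. -/
def Combines (E : ℕ → ℕ → Prop) (v : ℕ) (S T : Set ℕ) (k : ℕ) (T₁ : Set ℕ) (k₁ : ℕ)
    (S₂ T₂ : Set ℕ) (k₂ : ℕ) : Prop :=
  (∀ x, ¬ (x ∈ T₁ ∧ x ∈ T₂)) ∧
  (((∀ x, x ∈ S₂ ↔ x ∈ S ∧ v < x ∧ E v x) ∧ (∀ x, x ∈ T ↔ x ∈ T₁ ∨ x ∈ T₂) ∧ k = k₁ + k₂) ∨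
   ((∀ x, x ∈ S₂ ↔ x = v ∨ x ∈ S ∧ v < x ∧ E v x) ∧ v ∈ T₂ ∧
      (∀ x, x ∈ T ↔ x ∈ T₁ ∨ x ∈ T₂ ∧ x ≠ v) ∧ k = k₁ + k₂) ∨
   ((∀ x, x ∈ S₂ ↔ x = v ∨ x ∈ S ∧ v < x ∧ E v x) ∧ v ∉ T₂ ∧
      ∃ w, w ∈ S ∧ v < w ∧ E v w ∧ w ∉ T₁ ∧ w ∉ T₂ ∧ (∀ x, x ∈ T ↔ x ∈ T₁ ∨ x ∈ T₂ ∨ x = w) ∧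
        k = k₁ + k₂ + 1))

section Combine

variable {E : ℕ → ℕ → Prop} {r v k : ℕ} {R₁ R₂ S T : Set ℕ}

theorem covers_union {M M' : Finset (ℕ × ℕ)} {x : ℕ} :
    Covers (M ∪ M') x ↔ Covers M x ∨ Covers M' x := by
  simp only [Covers, Finset.mem_union]
  grind

theorem Covers.mono {M M' : Finset (ℕ × ℕ)} (h : M ⊆ M') {x : ℕ} : Covers M x → Covers M' x :=
  fun ⟨e, he, hx⟩ => ⟨e, h he, hx⟩

/-- A partial solution splits along non-adjacent sets `R₁` and `R₂` of vertices below `v`. -/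
theorem Feasible.split (h₁ : ∀ u ∈ R₁, u < v) (h₂ : ∀ u ∈ R₂, u < v)
    (h₁₂ : ∀ u, ¬ (u ∈ R₁ ∧ u ∈ R₂)) (N₁ : ∀ u ∈ R₁, ∀ w, E u w → w ∈ R₁ ∨ v < w)
    (N₂ : ∀ u ∈ R₂, ∀ w, E u w → w ∈ R₂ ∨ w = v ∨ v < w ∧ E v w) (hS : ∀ x ∈ S, v < x)
    (h : Feasible E r (R₁ ∪ R₂ ∪ {v}) S T k) :
    ∃ T₁ k₁ S₂ T₂ k₂, T₁ ⊆ S ∧ T₂ ⊆ S₂ ∧ (S.encard ≤ (r : ℕ∞) + 1 → S₂.encard ≤ (r : ℕ∞) + 1) ∧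
      Feasible E r R₁ S T₁ k₁ ∧ Feasible E r R₂ S₂ T₂ k₂ ∧
      Combines E v S T k T₁ k₁ S₂ T₂ k₂ := by
  classical
  obtain ⟨M, hM, rfl⟩ := h
  have e1 : ∀ e ∈ M, e.1 ∈ R₁ → e.2 ∈ R₁ ∨ e.2 ∈ S := by
    intro e he h1
    have := hM.low e he
    have h3 := N₁ _ h1 _ (hM.edge e he).2
    simp only [Set.mem_union, Set.mem_singleton_iff] at this
    grind
  have e2 : ∀ e ∈ M, e.1 ∈ R₂ → e.2 ∈ R₂ ∨ e.2 = v ∨ e.2 ∈ S ∧ v < e.2 ∧ E v e.2 := by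
    intro e he h1
    have := hM.low e he
    have h3 := N₂ _ h1 _ (hM.edge e he).2
    simp only [Set.mem_union, Set.mem_singleton_iff] at this
    grind
  have e3 : ∀ e ∈ M, e.1 = v → e.2 ∈ S ∧ v < e.2 ∧ E v e.2 := by
    intro e he h1
    have := hM.low e he
    have h3 := hM.edge e he
    simp only [Set.mem_union, Set.mem_singleton_iff] at this
    grind
  have e0 : ∀ e ∈ M, e.1 ∈ R₁ ∨ e.1 ∈ R₂ ∨ e.1 = v := by
    intro e he
    have := (hM.low e he).1
    simp only [Set.mem_union, Set.mem_singleton_iff] at this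
    tauto
  set M₁ := M.filter fun e => e.1 ∈ R₁ with hM₁
  set M₂ := M.filter fun e => e.1 ∈ R₂ with hM₂
  set M₃ := M.filter fun e => e.1 = v with hM₃
  have hsplit : M = M₁ ∪ M₂ ∪ M₃ := by
    ext e
    simp only [hM₁, hM₂, hM₃, Finset.mem_union, Finset.mem_filter]
    have := e0 e
    tauto
  have hcard : M.card = M₁.card + M₂.card + M₃.card := by
    conv_lhs => rw [hsplit]
    rw [Finset.card_union_of_disjoint, Finset.card_union_of_disjoint]
    · rw [Finset.disjoint_left]
      simp only [hM₁, hM₂, Finset.mem_filter]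
      exact fun e h h' => h₁₂ _ ⟨h.2, h'.2⟩
    · rw [Finset.disjoint_left]
      simp only [hM₁, hM₂, hM₃, Finset.mem_union, Finset.mem_filter]
      grind
  have hcov : ∀ x, Covers M x ↔ Covers M₁ x ∨ Covers M₂ x ∨ Covers M₃ x := by
    intro x
    conv_lhs => rw [hsplit]
    rw [covers_union, covers_union, or_assoc]
  have s1 : M₁ ⊆ M := Finset.filter_subset _ _
  have s2 : M₂ ⊆ M := Finset.filter_subset _ _
  have m1 : ∀ e, e ∈ M₁ ↔ e ∈ M ∧ e.1 ∈ R₁ := fun e => by simp [hM₁]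
  have m2 : ∀ e, e ∈ M₂ ↔ e ∈ M ∧ e.1 ∈ R₂ := fun e => by simp [hM₂]
  have m3 : ∀ e, e ∈ M₃ ↔ e ∈ M ∧ e.1 = v := fun e => by simp [hM₃]
  set S₂ : Set ℕ := {x | (x = v ∧ Covers M v) ∨ x ∈ S ∧ v < x ∧ E v x} with hS₂
  have hS₂sub : ∀ x ∈ S₂, Covers M x ∨ x ∈ S := by
    rintro x (⟨rfl, h⟩ | h)
    · exact Or.inl h
    · exact Or.inr h.1
  refine ⟨{x | x ∈ S ∧ Covers M₁ x}, M₁.card, S₂, {x | x ∈ S₂ ∧ Covers M₂ x}, M₂.card,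
    fun x hx => hx.1, fun x hx => hx.1, ?_, ⟨M₁, ⟨?_, ?_, ?_, fun x => Iff.rfl, ?_⟩, rfl⟩,
    ⟨M₂, ⟨?_, ?_, ?_, fun x => Iff.rfl, ?_⟩, rfl⟩, ?_⟩
  · intro hSc
    by_cases hv : Covers M v
    · have h1 := hM.deg v (by simp) hv
      have h2 : S₂ ⊆ insert v {y | v < y ∧ E v y ∧ (Covers M y ∨ y ∈ S)} := by
        rintro x (⟨rfl, -⟩ | h)
        · exact Set.mem_insert _ _
        · exact Set.mem_insert_of_mem _ ⟨h.2.1, h.2.2, Or.inr h.1⟩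
      calc S₂.encard ≤ _ := Set.encard_le_encard h2
        _ ≤ _ := Set.encard_insert_le _ _
        _ ≤ r + 1 := by gcongr
    · refine le_trans (Set.encard_le_encard ?_) hSc
      rintro x (⟨-, h⟩ | h)
      · exact absurd h hv
      · exact h.1
  · exact fun e he => hM.edge e (s1 he)
  · exact fun e he e' he' => hM.matching e (s1 he) e' (s1 he')
  · intro e he
    rw [m1] at he
    exact ⟨he.2, e1 e he.1 he.2⟩
  · intro x hx hxc
    refine le_trans (Set.encard_le_encard ?_) (hM.deg x (by simp [hx]) (hxc.mono s1))
    exact fun y hy => ⟨hy.1, hy.2.1, hy.2.2.imp_left (Covers.mono s1)⟩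
  · exact fun e he => hM.edge e (s2 he)
  · exact fun e he e' he' => hM.matching e (s2 he) e' (s2 he')
  · intro e he
    rw [m2] at he
    refine ⟨he.2, (e2 e he.1 he.2).imp_right ?_⟩
    rintro (h | h)
    · exact Or.inl ⟨h, e, he.1, Or.inr h⟩
    · exact Or.inr h
  · intro x hx hxc
    refine le_trans (Set.encard_le_encard ?_) (hM.deg x (by simp [hx]) (hxc.mono s2))
    intro y hy
    refine ⟨hy.1, hy.2.1, ?_⟩
    rcases hy.2.2 with h | h
    · exact Or.inl (h.mono s2)
    · exact hS₂sub y h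
  · have hS₂v : ∀ x, x ∈ S → Covers M₂ x → x ∈ S₂ := by
      rintro x hx ⟨e, he, hex⟩
      rw [m2] at he
      refine Or.inr ⟨hx, hS x hx, ?_⟩
      have := e2 e he.1 he.2
      have := hS x hx
      grind
    refine ⟨?_, ?_⟩
    · rintro x ⟨⟨-, e, he, hx⟩, -, e', he', hx'⟩
      rw [m1] at he
      rw [m2] at he'
      have := hM.matching e he.1 e' he'.1 x hx hx'
      subst this
      exact h₁₂ _ ⟨he.2, he'.2⟩
    · by_cases hv : Covers M v
      · have hS₂' : ∀ x, x ∈ S₂ ↔ x = v ∨ x ∈ S ∧ v < x ∧ E v x := by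
          intro x
          simp [hS₂, hv]
        refine Or.inr ?_
        have nv1 : ¬ Covers M₁ v := by
          rintro ⟨e, he, hx⟩
          rw [m1] at he
          have := e1 e he.1 he.2
          grind
        rcases M₃.eq_empty_or_nonempty with h3 | ⟨⟨v', w⟩, hw⟩
        · refine Or.inl ⟨hS₂', ⟨(hS₂' v).mpr (Or.inl rfl), ?_⟩, ?_, by rw [hcard, h3]; rfl⟩
          · have : ¬ Covers M₃ v := by rw [h3]; simp [Covers]
            have := hcov v
            tauto
          · intro x
            have c3 : ¬ Covers M₃ x := by rw [h3]; simp [Covers]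
            rw [hM.touched]
            constructor
            · rintro ⟨h, h'⟩
              rcases (hcov x).mp h' with h1 | h1 | h1
              · exact Or.inl ⟨h, h1⟩
              · exact Or.inr ⟨⟨hS₂v x h h1, h1⟩, (hS x h).ne'⟩
              · exact absurd h1 c3
            · rintro (⟨h, h1⟩ | ⟨⟨h, h1⟩, h2⟩)
              · exact ⟨h, h1.mono s1⟩
              · exact ⟨(((hS₂' x).mp h).resolve_left h2).1, h1.mono s2⟩
        · have hw' := hw
          rw [m3] at hw'
          obtain ⟨hwM, hv'⟩ := hw'
          simp only at hv'
          subst hv'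
          have hwS := e3 _ hwM rfl
          simp only at hwS
          have h3 : M₃ = {(v', w)} := by
            refine Finset.eq_singleton_iff_unique_mem.mpr ⟨hw, fun e he => ?_⟩
            rw [m3] at he
            exact hM.matching e he.1 _ hwM v' (Or.inl he.2) (Or.inl rfl)
          have c3 : ∀ x, Covers M₃ x ↔ x = v' ∨ x = w := by
            intro x
            rw [h3]
            simp only [Covers, Finset.mem_singleton, exists_eq_left]
            grind
          have no : ∀ x, (x = v' ∨ x = w) → ¬ Covers M₁ x ∧ ¬ Covers M₂ x := by
            intro x hx
            constructor
            · rintro ⟨e, he, hex⟩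
              rw [m1] at he
              have := hM.matching e he.1 _ hwM x hex (by grind)
              subst this
              exact absurd (h₁ _ he.2) (lt_irrefl _)
            · rintro ⟨e, he, hex⟩
              rw [m2] at he
              have := hM.matching e he.1 _ hwM x hex (by grind)
              subst this
              exact absurd (h₂ _ he.2) (lt_irrefl _)
          refine Or.inr ⟨hS₂', fun h => (no v' (Or.inl rfl)).2 h.2, w, hwS.1, hwS.2.1, hwS.2.2,
            fun h => (no w (Or.inr rfl)).1 h.2, fun h => (no w (Or.inr rfl)).2 h.2, ?_,
            by rw [hcard, h3]; rfl⟩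
          intro x
          rw [hM.touched]
          constructor
          · rintro ⟨h, h'⟩
            rcases (hcov x).mp h' with h1 | h1 | h1
            · exact Or.inl ⟨h, h1⟩
            · exact Or.inr (Or.inl ⟨hS₂v x h h1, h1⟩)
            · exact Or.inr (Or.inr (((c3 x).mp h1).resolve_left (hS x h).ne'))
          · rintro (⟨h, h1⟩ | ⟨h, h1⟩ | rfl)
            · exact ⟨h, h1.mono s1⟩
            · refine ⟨(((hS₂' x).mp h).resolve_left ?_).1, h1.mono s2⟩
              rintro rfl
              exact (no x (Or.inl rfl)).2 h1
            · exact ⟨hwS.1, (hcov x).mpr (Or.inr (Or.inr ((c3 x).mpr (Or.inr rfl))))⟩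
      · have hS₂' : ∀ x, x ∈ S₂ ↔ x ∈ S ∧ v < x ∧ E v x := fun x =>
          ⟨fun h => h.resolve_left fun h => hv h.2, Or.inr⟩
        have h3 : M₃ = ∅ := Finset.eq_empty_of_forall_notMem fun e he => by
          rw [m3] at he
          exact hv ⟨e, he.1, Or.inl he.2⟩
        refine Or.inl ⟨hS₂', ?_, by rw [hcard, h3]; rfl⟩
        intro x
        have c3 : ¬ Covers M₃ x := by rw [h3]; simp [Covers]
        rw [hM.touched]
        constructor
        · rintro ⟨h, h'⟩
          rcases (hcov x).mp h' with h1 | h1 | h1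
          · exact Or.inl ⟨h, h1⟩
          · exact Or.inr ⟨hS₂v x h h1, h1⟩
          · exact absurd h1 c3
        · rintro (⟨h, h1⟩ | ⟨h, h1⟩)
          · exact ⟨h, h1.mono s1⟩
          · exact ⟨((hS₂' x).mp h).1, h1.mono s2⟩

/-- Partial solutions for `R₁` and `R₂`, and possibly an edge from `v` to a larger vertex, which
form `M₃`, yield a partial solution for `R₁ ∪ R₂ ∪ {v}`. -/
theorem IsPartial.join {S₂ T₁ T₂ : Set ℕ} {M₁ M₂ M₃ : Finset (ℕ × ℕ)}
    (h₁ : ∀ u ∈ R₁, u < v) (h₂ : ∀ u ∈ R₂, u < v)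
    (h₁₂ : ∀ u, ¬ (u ∈ R₁ ∧ u ∈ R₂)) (N₁ : ∀ u ∈ R₁, ∀ w, E u w → w ∈ R₁ ∨ v < w)
    (N₂ : ∀ u ∈ R₂, ∀ w, E u w → w ∈ R₂ ∨ w = v ∨ v < w ∧ E v w) (hS : ∀ x ∈ S, v < x)
    (hM₁ : IsPartial E r R₁ S T₁ M₁) (hM₂ : IsPartial E r R₂ S₂ T₂ M₂)
    (hT : ∀ x, ¬ (x ∈ T₁ ∧ x ∈ T₂)) (hS₂ : ∀ x, x ≠ v → (x ∈ S₂ ↔ x ∈ S ∧ v < x ∧ E v x))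
    (hM₃ : ∀ e ∈ M₃, e.1 = v ∧ e.2 ∈ S ∧ v < e.2 ∧ E v e.2 ∧ e.2 ∉ T₁ ∧ e.2 ∉ T₂)
    (hM₃' : ∀ e ∈ M₃, ∀ e' ∈ M₃, e = e') (hM₃v : ∀ e ∈ M₃, v ∉ T₂)
    (hv : Covers (M₂ ∪ M₃) v ↔ v ∈ S₂) (hS₂r : v ∈ S₂ → S₂.encard ≤ (r : ℕ∞) + 1) :
    IsPartial E r (R₁ ∪ R₂ ∪ {v}) S {x | x ∈ S ∧ Covers (M₁ ∪ M₂ ∪ M₃) x} (M₁ ∪ M₂ ∪ M₃) ∧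
      (M₁ ∪ M₂ ∪ M₃).card = M₁.card + M₂.card + M₃.card := by
  classical
  -- where the ends of the edges are
  have e1 : ∀ e ∈ M₁, ∀ x, (e.1 = x ∨ e.2 = x) → x ∈ R₁ ∨ x ∈ S ∧ x ∈ T₁ := by
    intro e he x hx
    have h := hM₁.low e he
    have ht := (hM₁.touched x).mpr
    have hc : Covers M₁ x := ⟨e, he, hx⟩
    rcases hx with rfl | rfl
    · exact Or.inl h.1
    · exact h.2.imp_right fun h' => ⟨h', ht ⟨h', hc⟩⟩
  have e2 : ∀ e ∈ M₂, ∀ x, (e.1 = x ∨ e.2 = x) → x ∈ R₂ ∨ x ∈ S₂ ∧ x ∈ T₂ := by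
    intro e he x hx
    have h := hM₂.low e he
    have ht := (hM₂.touched x).mpr
    have hc : Covers M₂ x := ⟨e, he, hx⟩
    rcases hx with rfl | rfl
    · exact Or.inl h.1
    · exact h.2.imp_right fun h' => ⟨h', ht ⟨h', hc⟩⟩
  have S2v : ∀ x ∈ S₂, v ≤ x := by
    intro x hx
    by_cases hxv : x = v
    · exact hxv.ge
    · exact ((hS₂ x hxv).mp hx).2.1.le
  have c1 : ∀ x, Covers M₁ x → x ∈ R₁ ∨ x ∈ S ∧ x ∈ T₁ := fun x ⟨e, he, hx⟩ => e1 e he x hx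
  have c2 : ∀ x, Covers M₂ x → x ∈ R₂ ∨ x ∈ S₂ ∧ x ∈ T₂ := fun x ⟨e, he, hx⟩ => e2 e he x hx
  have c3 : ∀ x, Covers M₃ x → x = v ∧ v ∉ T₂ ∨ x ∈ S ∧ v < x ∧ E v x ∧ x ∉ T₁ ∧ x ∉ T₂ := by
    rintro x ⟨e, he, rfl | rfl⟩
    · exact Or.inl ⟨(hM₃ e he).1, hM₃v e he⟩
    · exact Or.inr (hM₃ e he).2
  have d12 : ∀ x, Covers M₁ x → ¬ Covers M₂ x := by
    intro x hx hx'
    have g1 := c1 x hx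
    have g2 := c2 x hx'
    have g3 := h₁ x
    have g4 := h₂ x
    have g5 := h₁₂ x
    have g6 := hT x
    have g7 := hS x
    have g8 := S2v x
    grind
  have d13 : ∀ x, Covers M₁ x → ¬ Covers M₃ x := by
    intro x hx hx'
    have g1 := c1 x hx
    have g2 := c3 x hx'
    have g3 := h₁ x
    have g7 := hS x
    grind
  have d23 : ∀ x, Covers M₂ x → ¬ Covers M₃ x := by
    intro x hx hx'
    have g1 := c2 x hx
    have g2 := c3 x hx'
    have g3 := h₂ x
    have g7 := hS x
    grind
  have cov : ∀ x, Covers (M₁ ∪ M₂ ∪ M₃) x ↔ Covers M₁ x ∨ Covers M₂ x ∨ Covers M₃ x := by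
    intro x
    rw [covers_union, covers_union, or_assoc]
  have mem : ∀ e, e ∈ M₁ ∪ M₂ ∪ M₃ ↔ e ∈ M₁ ∨ e ∈ M₂ ∨ e ∈ M₃ := by
    intro e
    rw [Finset.mem_union, Finset.mem_union, or_assoc]
  refine ⟨⟨?_, ?_, ?_, fun x => Iff.rfl, ?_⟩, ?_⟩
  · intro e he
    rcases (mem e).mp he with h | h | h
    · exact hM₁.edge e h
    · exact hM₂.edge e h
    · have := hM₃ e h
      rw [this.1]
      exact ⟨this.2.2.1, this.2.2.2.1⟩
  · intro e he e' he' x hx hx'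
    rcases (mem e).mp he with h | h | h <;> rcases (mem e').mp he' with h' | h' | h'
    · exact hM₁.matching e h e' h' x hx hx'
    · exact absurd ⟨e', h', hx'⟩ (d12 x ⟨e, h, hx⟩)
    · exact absurd ⟨e', h', hx'⟩ (d13 x ⟨e, h, hx⟩)
    · exact absurd ⟨e, h, hx⟩ (d12 x ⟨e', h', hx'⟩)
    · exact hM₂.matching e h e' h' x hx hx'
    · exact absurd ⟨e', h', hx'⟩ (d23 x ⟨e, h, hx⟩)
    · exact absurd ⟨e, h, hx⟩ (d13 x ⟨e', h', hx'⟩)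
    · exact absurd ⟨e, h, hx⟩ (d23 x ⟨e', h', hx'⟩)
    · exact hM₃' e h e' h'
  · intro e he
    simp only [Set.mem_union, Set.mem_singleton_iff]
    rcases (mem e).mp he with h | h | h
    · have := hM₁.low e h
      tauto
    · have h3 := hM₂.low e h
      by_cases hv2 : e.2 = v
      · tauto
      · have := hS₂ e.2 hv2
        tauto
    · have := hM₃ e h
      tauto
  · intro x hx hxc
    rw [cov] at hxc
    rcases hx with (hx | hx) | hx
    · have hxc1 : Covers M₁ x := by
        have g2 := c2 x
        have g3 := c3 x
        have g4 := h₁ x hx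
        have g5 := hS x
        have g6 := S2v x
        have g7 := h₁₂ x
        grind
      refine le_trans (Set.encard_le_encard ?_) (hM₁.deg x hx hxc1)
      rintro y ⟨hxy, hE, hy⟩
      refine ⟨hxy, hE, ?_⟩
      rw [cov] at hy
      have g1 := N₁ x hx y hE
      have g2 := c2 y
      have g3 := c3 y
      have g4 := h₁ y
      have g5 := h₂ y
      have g6 := h₁₂ y
      have g7 := hS₂ y
      have g8 := S2v y
      grind
    · have hxc2 : Covers M₂ x := by
        have g2 := c1 x
        have g3 := c3 x
        have g4 := h₂ x hx
        have g5 := hS x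
        have g7 := h₁₂ x
        grind
      refine le_trans (Set.encard_le_encard ?_) (hM₂.deg x hx hxc2)
      rintro y ⟨hxy, hE, hy⟩
      refine ⟨hxy, hE, ?_⟩
      by_cases hyv : y = v
      · subst hyv
        have g1 : ¬ Covers M₁ y := fun h => by
          have := c1 y h
          have := h₁ y
          have := hS y
          grind
        have g2 : y ∉ S := fun h => lt_irrefl _ (hS y h)
        rw [covers_union] at hv
        rw [cov] at hy
        tauto
      · rw [cov] at hy
        have g1 := N₂ x hx y hE
        have g2 := c1 y
        have g3 := c3 y
        have g4 := h₁ y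
        have g5 := h₂ y
        have g6 := h₁₂ y
        have g7 := hS₂ y hyv
        have g8 := hS y
        grind
    · obtain rfl : x = v := hx
      have hxS : x ∈ S₂ := by
        rw [← hv, covers_union]
        have g1 := c1 x
        have g2 := h₁ x
        have g3 := hS x
        grind
      have hsub : insert x {y | x < y ∧ E x y ∧ (Covers (M₁ ∪ M₂ ∪ M₃) y ∨ y ∈ S)} ⊆ S₂ := by
        intro y hy
        rcases hy with rfl | ⟨hxy, hE, hy⟩
        · exact hxS
        · rw [hS₂ y hxy.ne']
          refine ⟨?_, hxy, hE⟩
          rw [cov] at hy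
          have g1 := c1 y
          have g2 := c2 y
          have g3 := c3 y
          have g4 := h₁ y
          have g5 := h₂ y
          have g6 := hS₂ y hxy.ne'
          grind
      have hcard := (Set.encard_le_encard hsub).trans (hS₂r hxS)
      rw [Set.encard_insert_of_notMem (fun h => lt_irrefl _ h.1)] at hcard
      exact (ENat.add_le_add_iff_right ENat.one_ne_top).mp hcard
  · have key : ∀ {A B : Finset (ℕ × ℕ)}, (∀ x, Covers A x → ¬ Covers B x) → Disjoint A B := by
      intro A B h
      rw [Finset.disjoint_left]
      exact fun e he he' => h e.1 ⟨e, he, Or.inl rfl⟩ ⟨e, he', Or.inl rfl⟩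
    rw [Finset.card_union_of_disjoint, Finset.card_union_of_disjoint (key d12)]
    refine key fun x hx => ?_
    rcases covers_union.mp hx with h | h
    · exact d13 x h
    · exact d23 x h

theorem Feasible.join (h₁ : ∀ u ∈ R₁, u < v) (h₂ : ∀ u ∈ R₂, u < v)
    (h₁₂ : ∀ u, ¬ (u ∈ R₁ ∧ u ∈ R₂)) (N₁ : ∀ u ∈ R₁, ∀ w, E u w → w ∈ R₁ ∨ v < w)
    (N₂ : ∀ u ∈ R₂, ∀ w, E u w → w ∈ R₂ ∨ w = v ∨ v < w ∧ E v w) (hS : ∀ x ∈ S, v < x)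
    {T₁ S₂ T₂ : Set ℕ} {k₁ k₂ : ℕ} (hS₂ : S₂.encard ≤ (r : ℕ∞) + 1) (f₁ : Feasible E r R₁ S T₁ k₁)
    (f₂ : Feasible E r R₂ S₂ T₂ k₂) (hc : Combines E v S T k T₁ k₁ S₂ T₂ k₂) :
    Feasible E r (R₁ ∪ R₂ ∪ {v}) S T k := by
  classical
  obtain ⟨M₁, hM₁, rfl⟩ := f₁
  obtain ⟨M₂, hM₂, rfl⟩ := f₂
  obtain ⟨hT, hc⟩ := hc
  have hvS : v ∉ S := fun h => lt_irrefl _ (hS v h)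
  have hcv : Covers M₂ v → v ∈ S₂ := by
    rintro ⟨e, he, hx⟩
    have := hM₂.low e he
    have := h₂ v
    grind
  have hc2 : ∀ x, x ∈ S → Covers M₂ x → x ∈ S₂ := by
    rintro x hx ⟨e, he, hex⟩
    have := hM₂.low e he
    have := h₂ x
    have := hS x hx
    grind
  rcases hc with ⟨g1, g2, rfl⟩ | ⟨g1, g2, g3, rfl⟩ | ⟨g1, g2, w, w1, w2, w3, w4, w5, g3, rfl⟩
  · have hv2 : v ∉ S₂ := fun h => hvS ((g1 v).mp h).1
    obtain ⟨hJ, hcard⟩ := IsPartial.join (M₃ := ∅) h₁ h₂ h₁₂ N₁ N₂ hS hM₁ hM₂ hT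
      (fun x _ => g1 x) (by simp) (by simp) (by simp)
      (by rw [Finset.union_empty]; exact ⟨hcv, fun h => absurd h hv2⟩) (fun _ => hS₂)
    refine ⟨_, ?_, hcard⟩
    convert hJ using 1
    ext x
    rw [g2, Set.mem_ofPred_eq, Finset.union_empty, covers_union, hM₁.touched, hM₂.touched]
    have := hc2 x
    have := g1 x
    tauto
  · obtain ⟨hJ, hcard⟩ := IsPartial.join (M₃ := ∅) h₁ h₂ h₁₂ N₁ N₂ hS hM₁ hM₂ hT
      (fun x hx => by rw [g1 x]; tauto) (by simp) (by simp) (by simp)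
      (by rw [Finset.union_empty]; exact ⟨hcv, fun _ => ((hM₂.touched v).mp g2).2⟩) (fun _ => hS₂)
    refine ⟨_, ?_, hcard⟩
    convert hJ using 1
    ext x
    rw [g3, Set.mem_ofPred_eq, Finset.union_empty, covers_union, hM₁.touched, hM₂.touched]
    have := hc2 x
    have := g1 x
    have h3 : x ∈ S → x ≠ v := by rintro h rfl; exact hvS h
    tauto
  · obtain ⟨hJ, hcard⟩ := IsPartial.join (M₃ := {(v, w)}) h₁ h₂ h₁₂ N₁ N₂ hS hM₁ hM₂ hT
      (fun x hx => by rw [g1 x]; tauto)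
      (by simp only [Finset.mem_singleton, forall_eq]; exact ⟨trivial, w1, w2, w3, w4, w5⟩)
      (by simp) (by simp [g2])
      (by
        rw [covers_union]
        exact ⟨fun _ => (g1 v).mpr (Or.inl rfl), fun _ => Or.inr ⟨(v, w), by simp⟩⟩) (fun _ => hS₂)
    refine ⟨_, ?_, hcard⟩
    convert hJ using 1
    ext x
    have h4 : Covers {(v, w)} x ↔ x = v ∨ x = w := by
      simp only [Covers, Finset.mem_singleton, exists_eq_left]
      grind
    rw [g3, Set.mem_ofPred_eq, covers_union, covers_union, hM₁.touched, hM₂.touched, h4]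
    constructor
    · rintro (h | ⟨h, h'⟩ | rfl)
      · exact ⟨h.1, Or.inl (Or.inl h.2)⟩
      · refine ⟨(((g1 x).mp h).resolve_left ?_).1, Or.inl (Or.inr h')⟩
        rintro rfl
        exact g2 ((hM₂.touched x).mpr ⟨h, h'⟩)
      · exact ⟨w1, Or.inr (Or.inr rfl)⟩
    · rintro ⟨h, (h' | h') | rfl | rfl⟩
      · exact Or.inl ⟨h, h'⟩
      · exact Or.inr (Or.inl ⟨hc2 x h h', h'⟩)
      · exact absurd h hvS
      · exact Or.inr (Or.inr rfl)

end Combine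

/-! ### Elimination trees -/

/-- The natural order of `0, …, n - 1` is a perfect elimination ordering of the graph `E`: the larger
neighbours of every vertex form a clique. -/
structure IsPerfectElimination (n : ℕ) (E : ℕ → ℕ → Prop) : Prop where
  symm : ∀ i j, E i j → E j i
  irrefl : ∀ i, ¬ E i i
  lt : ∀ i j, E i j → i < n
  clique : ∀ i j k, i < j → i < k → j ≠ k → E i j → E i k → E j k

/-- The parent of `v` in the elimination tree: its smallest larger neighbour, or the additional root
`n` if `v` has no larger neighbour. -/
noncomputable def parent (n : ℕ) (E : ℕ → ℕ → Prop) (v : ℕ) : ℕ :=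
  sInf {q | q = n ∨ v < q ∧ E v q}

/-- The first ancestor of `u` that is not smaller than `v`. -/
noncomputable def ancestor (n : ℕ) (E : ℕ → ℕ → Prop) : ℕ → ℕ → ℕ
  | 0, u => u
  | v + 1, u => if ancestor n E v u = v then parent n E v else ancestor n E v u

/-- The vertices below `v` that hang, in the part of the elimination tree below `v`, on the
vertex `p`. -/
def region (n : ℕ) (E : ℕ → ℕ → Prop) (v p : ℕ) : Set ℕ := {u | u < v ∧ ancestor n E v u = p}

section Tree

variable {n : ℕ} {E : ℕ → ℕ → Prop}

theorem parent_spec (v : ℕ) :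
    parent n E v = n ∨ v < parent n E v ∧ E v (parent n E v) :=
  Nat.sInf_mem (s := {q | q = n ∨ v < q ∧ E v q}) ⟨n, Or.inl rfl⟩

theorem parent_le_root (v : ℕ) : parent n E v ≤ n :=
  Nat.sInf_le (s := {q | q = n ∨ v < q ∧ E v q}) (Or.inl rfl)

theorem parent_le {v q : ℕ} (h : v < q) (hE : E v q) : parent n E v ≤ q :=
  Nat.sInf_le (s := {q | q = n ∨ v < q ∧ E v q}) (Or.inr ⟨h, hE⟩)

theorem lt_parent {v : ℕ} (hv : v < n) : v < parent n E v := by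
  rcases parent_spec (n := n) (E := E) v with h | h
  · omega
  · exact h.1

theorem parent_eq_iff {v p : ℕ} :
    p = parent n E v ↔ (p = n ∨ v < p ∧ E v p) ∧ p ≤ n ∧ ∀ q < p, v < q → ¬ E v q := by
  constructor
  · rintro rfl
    exact ⟨parent_spec v, parent_le_root v, fun q hq hvq hE => absurd (parent_le (n := n) hvq hE) (by omega)⟩
  · rintro ⟨h1, h2, h3⟩
    apply le_antisymm
    · by_contra hlt
      push Not at hlt
      rcases parent_spec (n := n) (E := E) v with h | h
      · omega
      · exact h3 _ hlt h.1 h.2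
    · exact Nat.sInf_le (s := {q | q = n ∨ v < q ∧ E v q}) h1

theorem le_ancestor : ∀ v ≤ n, ∀ u, v ≤ ancestor n E v u := by
  intro v
  induction v with
  | zero => intro _ u; exact Nat.zero_le _
  | succ v ih =>
    intro hv u
    have h1 := ih (by omega) u
    rw [ancestor]
    split_ifs with h
    · exact lt_parent hv
    · omega

theorem ancestor_le : ∀ v u, u ≤ n → ancestor n E v u ≤ n := by
  intro v
  induction v with
  | zero => intro u hu; exact hu
  | succ v ih =>
    intro u hu
    rw [ancestor]
    split_ifs with h
    · exact parent_le_root v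
    · exact ih u hu

theorem ancestor_of_le : ∀ v u, v ≤ u → ancestor n E v u = u := by
  intro v
  induction v with
  | zero => intro u _; rfl
  | succ v ih =>
    intro u hu
    rw [ancestor, ih u (by omega), if_neg (by omega)]

/-- The neighbours of a region of the tree are in the region or in the clique that consists of its
root and the larger neighbours of its root. -/
theorem IsPerfectElimination.adj_region (hE : IsPerfectElimination n E) :
    ∀ v ≤ n, ∀ u w, u < v → E u w → w < v ∧ ancestor n E v w = ancestor n E v u ∨
      v ≤ w ∧ (w = ancestor n E v u ∨ ancestor n E v u < w ∧ E (ancestor n E v u) w) := by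
  intro v
  induction v with
  | zero => intro _ u w hu; omega
  | succ v ih =>
    intro hv u w hu huw
    have hvv : ancestor n E (v + 1) v = parent n E v := by
      rw [ancestor, ancestor_of_le v v le_rfl, if_pos rfl]
    -- the larger neighbours of `v`
    have up : ∀ x, v < x → E v x → x = parent n E v ∨ parent n E v < x ∧ E (parent n E v) x := by
      intro x hx hvx
      have h1 := parent_le (n := n) hx hvx
      rcases parent_spec (n := n) (E := E) v with h | ⟨h, h'⟩
      · have := hE.lt _ _ (hE.symm _ _ hvx)
        omega
      · by_cases hxp : x = parent n E v
        · exact Or.inl hxp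
        · exact Or.inr ⟨by omega, hE.clique v _ _ h hx (Ne.symm hxp) h' hvx⟩
    by_cases huv : u = v
    · subst huv
      rw [hvv]
      rcases lt_trichotomy w u with hw | rfl | hw
      · left
        refine ⟨by omega, ?_⟩
        rcases ih (by omega) w u hw (hE.symm _ _ huw) with h | ⟨-, h | ⟨h, -⟩⟩
        · omega
        · rw [ancestor, ← h, if_pos rfl]
        · have := le_ancestor (n := n) (E := E) u (by omega) w
          omega
      · exact absurd huw (hE.irrefl w)
      · exact Or.inr ⟨hw, up w hw huw⟩
    · have huv' : u < v := by omega
      have hle := le_ancestor (n := n) (E := E) v (by omega) u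
      rcases ih (by omega) u w huv' huw with ⟨h1, h2⟩ | ⟨h1, h2⟩
      · left
        refine ⟨by omega, ?_⟩
        rw [ancestor, ancestor, h2]
      · by_cases hroot : ancestor n E v u = v
        · rw [hroot] at h2
          rw [show ancestor n E (v + 1) u = parent n E v by rw [ancestor, if_pos hroot]]
          rcases h2 with rfl | ⟨h2, h3⟩
          · exact Or.inl ⟨by omega, hvv⟩
          · exact Or.inr ⟨h2, up w h2 h3⟩
        · rw [show ancestor n E (v + 1) u = ancestor n E v u by rw [ancestor, if_neg hroot]]
          exact Or.inr ⟨by omega, h2⟩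

theorem region_zero (p : ℕ) : region n E 0 p = ∅ := by
  ext u; simp [region]

theorem region_root : region n E n n = {u | u < n} := by
  ext u
  simp only [region, Set.mem_ofPred_eq, and_iff_left_iff_imp]
  intro hu
  exact le_antisymm (ancestor_le n u hu.le) (le_ancestor n le_rfl u)

theorem region_succ_of_ne {v p : ℕ} (hp : p ≠ parent n E v) (hvp : v < p) :
    region n E (v + 1) p = region n E v p := by
  ext u
  simp only [region, Set.mem_ofPred_eq, ancestor]
  constructor
  · rintro ⟨h1, h2⟩
    split_ifs at h2 with h
    · exact absurd h2.symm hp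
    · refine ⟨?_, h2⟩
      by_contra hlt
      obtain rfl : u = v := by omega
      exact h (ancestor_of_le u u le_rfl)
  · rintro ⟨h1, h2⟩
    rw [if_neg (by omega)]
    exact ⟨by omega, h2⟩

theorem region_succ_parent {v : ℕ} (hv : v < n) :
    region n E (v + 1) (parent n E v) =
      region n E v (parent n E v) ∪ region n E v v ∪ {v} := by
  have hp := lt_parent (E := E) hv
  ext u
  simp only [region, Set.mem_ofPred_eq, ancestor, Set.mem_union, Set.mem_singleton_iff]
  by_cases huv : u = v
  · subst huv
    rw [ancestor_of_le u u le_rfl]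
    simp
  · by_cases h : ancestor n E v u = v
    · rw [if_pos h]
      have : u < v + 1 ↔ u < v := by omega
      simp only [this, h]
      tauto
    · rw [if_neg h]
      have : u < v + 1 ↔ u < v := by omega
      simp only [this, h, huv]
      tauto

/-- The recursion along the elimination tree. -/
theorem IsPerfectElimination.feasible_succ_parent (hE : IsPerfectElimination n E) {r v k : ℕ}
    (hv : v < n) {S T : Set ℕ} (hS : ∀ x ∈ S, v < x) (hSr : S.encard ≤ (r : ℕ∞) + 1) :
    Feasible E r (region n E (v + 1) (parent n E v)) S T k ↔
      ∃ T₁ k₁ S₂ T₂ k₂, T₁ ⊆ S ∧ T₂ ⊆ S₂ ∧ S₂.encard ≤ (r : ℕ∞) + 1 ∧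
        Feasible E r (region n E v (parent n E v)) S T₁ k₁ ∧
        Feasible E r (region n E v v) S₂ T₂ k₂ ∧ Combines E v S T k T₁ k₁ S₂ T₂ k₂ := by
  have hp := lt_parent (E := E) hv
  have h₁ : ∀ u ∈ region n E v (parent n E v), u < v := fun u hu => hu.1
  have h₂ : ∀ u ∈ region n E v v, u < v := fun u hu => hu.1
  have h₁₂ : ∀ u, ¬ (u ∈ region n E v (parent n E v) ∧ u ∈ region n E v v) := by
    rintro u ⟨⟨-, h⟩, -, h'⟩
    omega
  have N₁ : ∀ u ∈ region n E v (parent n E v), ∀ w, E u w →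
      w ∈ region n E v (parent n E v) ∨ v < w := by
    rintro u ⟨hu, hu'⟩ w huw
    rcases hE.adj_region v hv.le u w hu huw with h | h
    · exact Or.inl ⟨h.1, h.2.trans hu'⟩
    · rw [hu'] at h
      omega
  have N₂ : ∀ u ∈ region n E v v, ∀ w, E u w → w ∈ region n E v v ∨ w = v ∨ v < w ∧ E v w := by
    rintro u ⟨hu, hu'⟩ w huw
    rcases hE.adj_region v hv.le u w hu huw with h | h
    · exact Or.inl ⟨h.1, h.2.trans hu'⟩
    · rw [hu'] at h
      exact Or.inr h.2
  rw [region_succ_parent hv]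
  constructor
  · intro h
    obtain ⟨T₁, k₁, S₂, T₂, k₂, g1, g2, g3, g4, g5, g6⟩ := h.split h₁ h₂ h₁₂ N₁ N₂ hS
    exact ⟨T₁, k₁, S₂, T₂, k₂, g1, g2, g3 hSr, g4, g5, g6⟩
  · rintro ⟨T₁, k₁, S₂, T₂, k₂, -, -, g3, g4, g5, g6⟩
    exact Feasible.join h₁ h₂ h₁₂ N₁ N₂ hS g3 g4 g5 g6

/-! ### The table of the dynamic program -/

/-- The entry for `v`, `p`, `s`, `t`, `k` of the table, in terms of the previous entries `F`. The sets
of vertices are given by codes: `mem s` is the set with the code `s`. -/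
def TableStep (n : ℕ) (E : ℕ → ℕ → Prop) (mem : ℕ → Set ℕ) (M : ℕ)
    (F : ℕ → ℕ → ℕ → ℕ → ℕ → Prop) (v p s t k : ℕ) : Prop :=
  (v = 0 ∧ mem t = ∅ ∧ k = 0) ∨
  ∃ u < v, v = u + 1 ∧
    ((p ≠ parent n E u ∧ F u p s t k) ∨
     (p = parent n E u ∧ ∃ t₁ < M, ∃ k₁ < M, ∃ s₂ < M, ∃ t₂ < M, ∃ k₂ < M,
        F u p s t₁ k₁ ∧ F u u s₂ t₂ k₂ ∧
        Combines E u (mem s) (mem t) k (mem t₁) k₁ (mem s₂) (mem t₂) k₂))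

/-- A table that obeys the recursion tells which partial solutions exist. -/
theorem IsPerfectElimination.table_iff (hE : IsPerfectElimination n E) {r M : ℕ}
    {mem : ℕ → Set ℕ} (hmem : ∀ s < M, (mem s).encard ≤ (r : ℕ∞) + 1 ∧ ∀ x ∈ mem s, x ≤ n)
    (hcode : ∀ S : Set ℕ, S.encard ≤ (r : ℕ∞) + 1 → (∀ x ∈ S, x ≤ n) → ∃ s < M, mem s = S)
    {F : ℕ → ℕ → ℕ → ℕ → ℕ → Prop}
    (hF : ∀ v p s t k, v ≤ n → p ≤ n → s < M → t < M → k < M →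
      (F v p s t k ↔ TableStep n E mem M F v p s t k)) :
    ∀ v ≤ n, ∀ p, v ≤ p → p ≤ n → ∀ s < M, ∀ t < M, ∀ k < M, (∀ x ∈ mem s, v ≤ x) →
      (F v p s t k ↔ Feasible E r (region n E v p) (mem s) (mem t) k) := by
  intro v
  induction v with
  | zero =>
    intro hv p _ hp s hs t ht k hk _
    rw [hF 0 p s t k hv hp hs ht hk, region_zero, feasible_empty_region]
    simp [TableStep]
  | succ v ih =>
    intro hv p hvp hp s hs t ht k hk hS
    rw [hF _ p s t k hv hp hs ht hk]
    have hstep : TableStep n E mem M F (v + 1) p s t k ↔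
        ((p ≠ parent n E v ∧ F v p s t k) ∨
         (p = parent n E v ∧ ∃ t₁ < M, ∃ k₁ < M, ∃ s₂ < M, ∃ t₂ < M, ∃ k₂ < M,
          F v p s t₁ k₁ ∧ F v v s₂ t₂ k₂ ∧
          Combines E v (mem s) (mem t) k (mem t₁) k₁ (mem s₂) (mem t₂) k₂)) := by
      constructor
      · rintro (⟨h, -⟩ | ⟨u, -, hu, h⟩)
        · omega
        · obtain rfl : v = u := by omega
          exact h
      · exact fun h => Or.inr ⟨v, by omega, rfl, h⟩
    rw [hstep]
    have hSv : ∀ x ∈ mem s, v ≤ x := fun x hx => by have := hS x hx; omega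
    by_cases hpar : p = parent n E v
    · subst hpar
      rw [hE.feasible_succ_parent (by omega) hS (hmem s hs).1]
      simp only [ne_eq, not_true_eq_false, false_and, true_and, false_or]
      have hS2 : ∀ {S₂ T₁ T₂ : Set ℕ} {T : Set ℕ} {k k₁ k₂ : ℕ},
          Combines E v (mem s) T k T₁ k₁ S₂ T₂ k₂ →
          (∀ x ∈ S₂, v ≤ x ∧ x ≤ n) ∧ k₁ ≤ k ∧ k₂ ≤ k := by
        intro S₂ T₁ T₂ T k k₁ k₂ hc
        refine ⟨fun x hx => ?_, ?_, ?_⟩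
        · have h1 : x ∈ mem s → x ≤ n := (hmem s hs).2 x
          rcases hc.2 with ⟨h, -⟩ | ⟨h, -⟩ | ⟨h, -⟩ <;> have := (h x).mp hx <;> grind
        · rcases hc.2 with ⟨-, -, h⟩ | ⟨-, -, -, h⟩ | ⟨-, -, w, -, -, -, -, -, -, h⟩ <;> omega
        · rcases hc.2 with ⟨-, -, h⟩ | ⟨-, -, -, h⟩ | ⟨-, -, w, -, -, -, -, -, -, h⟩ <;> omega
      constructor
      · rintro ⟨t₁, ht₁, k₁, hk₁, s₂, hs₂, t₂, ht₂, k₂, hk₂, g1, g2, g3⟩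
        obtain ⟨b1, b2, b3⟩ := hS2 g3
        rw [ih (by omega) _ (by omega) hp s hs t₁ ht₁ k₁ hk₁ hSv] at g1
        rw [ih (by omega) v le_rfl (by omega) s₂ hs₂ t₂ ht₂ k₂ hk₂ fun x hx => (b1 x hx).1] at g2
        obtain ⟨M₁, hM₁, -⟩ := id g1
        obtain ⟨M₂, hM₂, -⟩ := id g2
        exact ⟨mem t₁, k₁, mem s₂, mem t₂, k₂, fun x hx => ((hM₁.touched x).mp hx).1,
          fun x hx => ((hM₂.touched x).mp hx).1, (hmem s₂ hs₂).1, g1, g2, g3⟩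
      · rintro ⟨T₁, k₁, S₂, T₂, k₂, c1, c2, c3, g1, g2, g3⟩
        obtain ⟨b1, b2, b3⟩ := hS2 g3
        obtain ⟨t₁, ht₁, rfl⟩ := hcode T₁ ((Set.encard_le_encard c1).trans (hmem s hs).1)
          fun x hx => (hmem s hs).2 x (c1 hx)
        obtain ⟨s₂, hs₂, rfl⟩ := hcode S₂ c3 fun x hx => (b1 x hx).2
        obtain ⟨t₂, ht₂, rfl⟩ := hcode T₂ ((Set.encard_le_encard c2).trans c3)
          fun x hx => (b1 x (c2 hx)).2
        refine ⟨t₁, ht₁, k₁, by omega, s₂, hs₂, t₂, ht₂, k₂, by omega, ?_, ?_, g3⟩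
        · rwa [ih (by omega) _ (by omega) hp s hs t₁ ht₁ k₁ (by omega) hSv]
        · rwa [ih (by omega) v le_rfl (by omega) s₂ hs₂ t₂ ht₂ k₂ (by omega)
            fun x hx => (b1 x hx).1]
    · rw [region_succ_of_ne hpar (by omega), ← ih (by omega) p (by omega) hp s hs t ht k hk hSv]
      simp [hpar]

end Tree

/-! ### Codes of small sets -/

/-- The set with the code `s`, where the element `x` corresponds to the digit `x + 1` of `s` in
base `B`; the digit `0` is ignored. Sets of at most `m` numbers below `B - 1` thus have codes below
`B ^ m`. -/
def codedSet (B s : ℕ) : Set ℕ := {x | x + 1 ∈ Nat.digits B s}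

theorem codedSet_zero (B : ℕ) : codedSet B 0 = ∅ := by
  simp [codedSet]

theorem mem_codedSet_iff {B s x : ℕ} (hB : 2 ≤ B) :
    x ∈ codedSet B s ↔ s ≠ 0 ∧ (s % B = x + 1 ∨ x ∈ codedSet B (s / B)) := by
  rcases Nat.eq_zero_or_pos s with rfl | hs
  · simp [codedSet]
  · simp only [codedSet, Set.mem_ofPred_eq]
    rw [Nat.digits_def' hB hs, List.mem_cons]
    have : s ≠ 0 := hs.ne'
    tauto

theorem lt_of_mem_codedSet {B s x : ℕ} (hB : 2 ≤ B) (hx : x ∈ codedSet B s) : x + 1 < B :=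
  Nat.digits_lt_base hB hx

theorem encard_codedSet_le {B s m : ℕ} (hB : 2 ≤ B) (hs : s < B ^ m) :
    (codedSet B s).encard ≤ m := by
  classical
  have hlen : (Nat.digits B s).length ≤ m := (Nat.digits_length_le_iff hB s).mpr hs
  have hsub : codedSet B s ⊆ (((Nat.digits B s).map (· - 1)).toFinset : Set ℕ) := by
    intro x hx
    simp only [List.coe_toFinset, List.mem_map, Set.mem_ofPred_eq]
    exact ⟨x + 1, hx, rfl⟩
  refine (Set.encard_le_encard hsub).trans ?_
  rw [Set.encard_coe_eq_coe_finsetCard]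
  have h := List.toFinset_card_le ((Nat.digits B s).map (· - 1))
  rw [List.length_map] at h
  exact_mod_cast h.trans hlen

theorem exists_codedSet_eq {B m : ℕ} (hB : 2 ≤ B) {S : Set ℕ} (hS : S.encard ≤ m)
    (hSB : ∀ x ∈ S, x + 1 < B) : ∃ s < B ^ m, codedSet B s = S := by
  have hfin : S.Finite := Set.finite_of_encard_le_coe hS
  set l : List ℕ := hfin.toFinset.toList.map (· + 1) with hl
  have hmem : ∀ y, y ∈ l ↔ ∃ x ∈ S, x + 1 = y := by
    intro y; simp [hl]
  have hdig : Nat.digits B (Nat.ofDigits B l) = l := by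
    refine Nat.digits_ofDigits B hB l (fun y hy => ?_) fun h h0 => ?_
    · obtain ⟨x, hx, rfl⟩ := (hmem y).mp hy
      exact hSB x hx
    · obtain ⟨x, -, hx⟩ := (hmem _).mp (List.getLast_mem h)
      omega
  have hlen : l.length ≤ m := by
    rw [hl, List.length_map, Finset.length_toList]
    rw [hfin.encard_eq_coe_toFinset_card] at hS
    exact_mod_cast hS
  refine ⟨Nat.ofDigits B l, ?_, ?_⟩
  · refine (Nat.digits_length_le_iff hB _).mp ?_
    rwa [hdig]
  · ext x
    simp only [codedSet, hdig, Set.mem_ofPred_eq, hmem]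
    constructor
    · rintro ⟨y, hy, hxy⟩
      obtain rfl : y = x := by omega
      exact hy
    · exact fun hx => ⟨x, hx, rfl⟩

/-! ### Degenerate matchings and perfect elimination orderings -/

section Degenerate

variable {V : Type*} {G : SimpleGraph V} {pos : V → ℕ}

/-- The graph `G`, with every vertex replaced by its position. -/
def positionGraph (G : SimpleGraph V) (pos : V → ℕ) (i j : ℕ) : Prop :=
  ∃ a b, G.Adj a b ∧ pos a = i ∧ pos b = j

/-- An induced subgraph of a graph with a perfect elimination ordering is `r`-degenerate if and only
if each of its vertices has at most `r` larger neighbours: a vertex together with its larger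
neighbours is a clique. -/
theorem isDegenerate_induce_iff (hpos : Function.Injective pos)
    (hcl : ∀ a b c, pos a < pos b → pos a < pos c → b ≠ c → G.Adj a b → G.Adj a c → G.Adj b c)
    (X : Set V) (r : ℕ) :
    IsDegenerate (G.induce X) r ↔
      ∀ a ∈ X, {b | b ∈ X ∧ G.Adj a b ∧ pos a < pos b}.encard ≤ r := by
  constructor
  · intro h a ha
    set U : Set X := {b | G.Adj a b ∧ pos a < pos b} with hU
    have hUim : {b | b ∈ X ∧ G.Adj a b ∧ pos a < pos b} = Subtype.val '' U := by
      ext b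
      simp only [hU, Set.mem_ofPred_eq, Set.mem_image, Subtype.exists, exists_and_right,
        exists_eq_right]
      exact ⟨fun ⟨h1, h2, h3⟩ => ⟨⟨h1, h2⟩, h3⟩, fun ⟨⟨h1, h2⟩, h3⟩ => ⟨h1, h2, h3⟩⟩
    rw [hUim, Subtype.val_injective.encard_image]
    set K : Set X := insert ⟨a, ha⟩ U with hK
    have haU : (⟨a, ha⟩ : X) ∉ U := fun h => lt_irrefl _ h.2
    have hclique : ∀ x ∈ K, ∀ y ∈ K, x ≠ y → G.Adj x y := by
      intro x hx y hy hxy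
      rcases hx with rfl | hx <;> rcases hy with rfl | hy
      · exact absurd rfl hxy
      · exact hy.1
      · exact hx.1.symm
      · exact hcl a x y hx.2 hy.2 (fun h => hxy (Subtype.ext h)) hx.1 hy.1
    obtain ⟨v, hv, hdeg⟩ := h ((⊤ : (G.induce X).Subgraph).induce K) ⟨⟨a, ha⟩, Set.mem_insert _ _⟩
    have hvK : v ∈ K := hv
    have hsub : K \ {v} ⊆ ((⊤ : (G.induce X).Subgraph).induce K).neighborSet v := by
      rintro x ⟨hx, hxv⟩
      rw [SimpleGraph.Subgraph.mem_neighborSet, SimpleGraph.Subgraph.induce_adj]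
      exact ⟨hvK, hx, hclique v hvK x hx fun h => hxv h.symm⟩
    have h1 := (Set.encard_le_encard hsub).trans hdeg
    have h2 : (K \ {v}).encard + 1 = U.encard + 1 := by
      rw [Set.encard_sdiff_singleton_add_one hvK, Set.encard_insert_of_notMem haU]
    have h3 : (K \ {v}).encard = U.encard := by
      apply le_antisymm
      · exact (ENat.add_le_add_iff_right ENat.one_ne_top).mp h2.le
      · exact (ENat.add_le_add_iff_right ENat.one_ne_top).mp h2.ge
    rwa [h3] at h1
  · intro h H hH
    obtain ⟨v, hv, hmin⟩ : ∃ v ∈ H.verts, ∀ w ∈ H.verts, pos v ≤ pos w := by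
      have hne : ((fun x : X => pos x) '' H.verts).Nonempty := hH.image _
      obtain ⟨v, hv, hvm⟩ := Nat.sInf_mem hne
      refine ⟨v, hv, fun w hw => ?_⟩
      simp only at hvm
      rw [hvm]
      exact Nat.sInf_le ⟨w, hw, rfl⟩
    refine ⟨v, hv, le_trans ?_ (h v v.2)⟩
    rw [← Subtype.val_injective.encard_image]
    refine Set.encard_le_encard ?_
    rintro _ ⟨w, hw, rfl⟩
    have hadj : G.Adj v w := H.adj_sub hw
    refine ⟨w.2, hadj, lt_of_le_of_ne (hmin w (H.edge_vert (SimpleGraph.Subgraph.Adj.symm hw))) fun he => ?_⟩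
    exact hadj.ne (hpos he)

theorem ncard_edgeSet_eq [Fintype V] (hpos : Function.Injective pos) (M : G.Subgraph)
    {P : Finset (ℕ × ℕ)} (hP : ∀ i j, (i, j) ∈ P ↔ ∃ a b, M.Adj a b ∧ i < j ∧ pos a = i ∧ pos b = j) :
    M.edgeSet.ncard = P.card := by
  classical
  set Q : Finset (V × V) := Finset.univ.filter fun e => M.Adj e.1 e.2 ∧ pos e.1 < pos e.2 with hQ
  have h1 : P = Q.image (Prod.map pos pos) := by
    ext ⟨i, j⟩
    rw [hP]
    simp only [hQ, Finset.mem_image, Finset.mem_filter, Finset.mem_univ, true_and, Prod.exists,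
      Prod.map_apply, Prod.mk.injEq]
    constructor
    · rintro ⟨a, b, h, hij, rfl, rfl⟩
      exact ⟨a, b, ⟨h, hij⟩, rfl, rfl⟩
    · rintro ⟨a, b, ⟨h, hij⟩, rfl, rfl⟩
      exact ⟨a, b, h, hij, rfl, rfl⟩
  have h2 : M.edgeSet = (fun e : V × V => s(e.1, e.2)) '' (Q : Set (V × V)) := by
    ext e
    induction e using Sym2.ind with
    | _ a b =>
    simp only [SimpleGraph.Subgraph.mem_edgeSet, hQ, Set.mem_image, Finset.coe_filter,
      Finset.mem_univ, true_and, Set.mem_ofPred_eq, Prod.exists]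
    constructor
    · intro h
      rcases lt_trichotomy (pos a) (pos b) with hab | hab | hab
      · exact ⟨a, b, ⟨h, hab⟩, rfl⟩
      · exact absurd (hpos hab) h.ne
      · exact ⟨b, a, ⟨h.symm, hab⟩, Sym2.eq_swap⟩
    · rintro ⟨c, d, ⟨h, -⟩, he⟩
      rw [Sym2.eq_iff] at he
      rcases he with ⟨rfl, rfl⟩ | ⟨rfl, rfl⟩
      · exact h
      · exact h.symm
  rw [h1, Finset.card_image_of_injective _ (hpos.prodMap hpos), h2, Set.InjOn.ncard_image,
    Set.ncard_coe_finset]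
  rintro ⟨a, b⟩ hab ⟨c, d⟩ hcd he
  simp only [hQ, Finset.coe_filter, Finset.mem_univ, true_and, Set.mem_ofPred_eq] at hab hcd
  rcases Sym2.eq_iff.mp he with ⟨h, h'⟩ | ⟨h, h'⟩
  · simp only at h h'
    rw [h, h']
  · simp only at h h'
    rw [h, h'] at hab
    omega

/-- In terms of positions, the degenerate matchings of `G` are the partial solutions for the set of
all vertices. -/
theorem mem_degenerateMatchingSizes_iff [Fintype V] {n : ℕ} (hpos : Function.Injective pos)
    (hlt : ∀ a, pos a < n) (hE : IsPerfectElimination n (positionGraph G pos)) (r k : ℕ) :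
    k ∈ degenerateMatchingSizes G r ↔
      Feasible (positionGraph G pos) r {u | u < n} ∅ ∅ k := by
  classical
  have hcl : ∀ a b c, pos a < pos b → pos a < pos c → b ≠ c → G.Adj a b → G.Adj a c →
      G.Adj b c := by
    intro a b c hab hac hbc h h'
    obtain ⟨b', c', hadj, hb, hc⟩ := hE.clique _ _ _ hab hac (fun e => hbc (hpos e))
      ⟨a, b, h, rfl, rfl⟩ ⟨a, c, h', rfl, rfl⟩
    rwa [hpos hb, hpos hc] at hadj
  have key : ∀ (M : G.Subgraph) (P : Finset (ℕ × ℕ)), (∀ x, Covers P x ↔ ∃ a ∈ M.verts, pos a = x) →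
      (IsDegenerate (G.induce M.verts) r ↔ ∀ x ∈ {u | u < n}, Covers P x →
        {y | x < y ∧ positionGraph G pos x y ∧ (Covers P y ∨ y ∈ (∅ : Set ℕ))}.encard ≤ r) := by
    intro M P hP
    rw [isDegenerate_induce_iff hpos hcl]
    have hset : ∀ a, {y | pos a < y ∧ positionGraph G pos (pos a) y ∧
        (Covers P y ∨ y ∈ (∅ : Set ℕ))} = pos '' {b | b ∈ M.verts ∧ G.Adj a b ∧ pos a < pos b} := by
      intro a
      ext y
      simp only [Set.mem_ofPred_eq, Set.mem_empty_iff_false, or_false, Set.mem_image, hP]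
      constructor
      · rintro ⟨h1, ⟨a', b, hab, ha', rfl⟩, b', hb', hbb⟩
        rw [hpos ha'] at hab
        rw [hpos hbb] at hb'
        exact ⟨b, ⟨hb', hab, h1⟩, rfl⟩
      · rintro ⟨b, ⟨h1, h2, h3⟩, rfl⟩
        exact ⟨h3, ⟨a, b, h2, rfl, rfl⟩, b, h1, rfl⟩
    constructor
    · intro h x _ hx
      obtain ⟨a, ha, rfl⟩ := (hP x).mp hx
      rw [hset, hpos.encard_image]
      exact h a ha
    · intro h a ha
      have := h (pos a) (hlt a) ((hP _).mpr ⟨a, ha, rfl⟩)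
      rwa [hset, hpos.encard_image] at this
  constructor
  · rintro ⟨M, hM, hdeg, rfl⟩
    set P : Finset (ℕ × ℕ) := (Finset.univ.filter fun e : V × V => M.Adj e.1 e.2 ∧
      pos e.1 < pos e.2).image (Prod.map pos pos) with hPdef
    have hP : ∀ i j, (i, j) ∈ P ↔ ∃ a b, M.Adj a b ∧ i < j ∧ pos a = i ∧ pos b = j := by
      intro i j
      simp only [hPdef, Finset.mem_image, Finset.mem_filter, Finset.mem_univ, true_and,
        Prod.exists, Prod.map_apply, Prod.mk.injEq]
      constructor
      · rintro ⟨a, b, ⟨h, hij⟩, rfl, rfl⟩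
        exact ⟨a, b, h, hij, rfl, rfl⟩
      · rintro ⟨a, b, h, hij, rfl, rfl⟩
        exact ⟨a, b, ⟨h, hij⟩, rfl, rfl⟩
    have hcov : ∀ x, Covers P x ↔ ∃ a ∈ M.verts, pos a = x := by
      intro x
      constructor
      · rintro ⟨⟨i, j⟩, he, hx⟩
        obtain ⟨a, b, hab, -, rfl, rfl⟩ := (hP i j).mp he
        rcases hx with rfl | rfl
        · exact ⟨a, M.edge_vert hab, rfl⟩
        · exact ⟨b, M.edge_vert hab.symm, rfl⟩
      · rintro ⟨a, ha, rfl⟩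
        obtain ⟨b, hb, -⟩ := hM ha
        rcases lt_trichotomy (pos a) (pos b) with h | h | h
        · exact ⟨(pos a, pos b), (hP _ _).mpr ⟨a, b, hb, h, rfl, rfl⟩, Or.inl rfl⟩
        · exact absurd (hpos h) hb.ne
        · exact ⟨(pos b, pos a), (hP _ _).mpr ⟨b, a, hb.symm, h, rfl, rfl⟩, Or.inr rfl⟩
    refine ⟨P, ⟨?_, ?_, ?_, fun x => by simp, (key M P hcov).mp hdeg⟩,
      (ncard_edgeSet_eq hpos M hP).symm⟩
    · rintro ⟨i, j⟩ he
      obtain ⟨a, b, hab, hij, rfl, rfl⟩ := (hP i j).mp he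
      exact ⟨hij, a, b, hab.adj_sub, rfl, rfl⟩
    · rintro ⟨i, j⟩ he ⟨i', j'⟩ he' x hx hx'
      obtain ⟨a, b, hab, hij, rfl, rfl⟩ := (hP i j).mp he
      obtain ⟨a', b', hab', hij', rfl, rfl⟩ := (hP i' j').mp he'
      simp only at hx hx'
      have uniq : ∀ {u v w}, M.Adj u v → M.Adj u w → v = w := by
        intro u v w h h'
        obtain ⟨z, -, hz⟩ := hM (M.edge_vert h)
        rw [hz v h, hz w h']
      rcases hx with hx | hx <;> rcases hx' with hx' | hx'
      · obtain rfl : a = a' := hpos (hx.trans hx'.symm)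
        rw [uniq hab hab']
      · obtain rfl : a = b' := hpos (hx.trans hx'.symm)
        rw [uniq hab hab'.symm] at hij
        omega
      · obtain rfl : b = a' := hpos (hx.trans hx'.symm)
        rw [uniq hab.symm hab'] at hij
        omega
      · obtain rfl : b = b' := hpos (hx.trans hx'.symm)
        rw [uniq hab.symm hab'.symm]
    · rintro ⟨i, j⟩ he
      obtain ⟨a, b, hab, hij, rfl, rfl⟩ := (hP i j).mp he
      exact ⟨hlt a, Or.inl (hlt b)⟩
  · rintro ⟨P, hP, rfl⟩
    have hsub : ∀ {a b}, ((pos a, pos b) ∈ P ∨ (pos b, pos a) ∈ P) → G.Adj a b := by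
      rintro a b (h | h)
      · obtain ⟨a', b', hab, ha, hb⟩ := (hP.edge _ h).2
        rwa [hpos ha, hpos hb] at hab
      · obtain ⟨a', b', hab, ha, hb⟩ := (hP.edge _ h).2
        rw [hpos ha, hpos hb] at hab
        exact hab.symm
    let M : G.Subgraph :=
      { verts := {a | Covers P (pos a)}
        Adj := fun a b => (pos a, pos b) ∈ P ∨ (pos b, pos a) ∈ P
        adj_sub := hsub
        edge_vert := by
          rintro a b (h | h)
          · exact ⟨_, h, Or.inl rfl⟩
          · exact ⟨_, h, Or.inr rfl⟩
        symm := ⟨fun a b h => h.symm⟩ }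
    have hends : ∀ e ∈ P, ∃ a b, e = (pos a, pos b) := by
      intro e he
      obtain ⟨a, b, -, ha, hb⟩ := (hP.edge e he).2
      exact ⟨a, b, by rw [ha, hb]⟩
    have hcov : ∀ x, Covers P x ↔ ∃ a ∈ M.verts, pos a = x := by
      intro x
      constructor
      · rintro ⟨e, he, hx⟩
        obtain ⟨a, b, rfl⟩ := hends e he
        rcases hx with rfl | rfl
        · exact ⟨a, ⟨_, he, Or.inl rfl⟩, rfl⟩
        · exact ⟨b, ⟨_, he, Or.inr rfl⟩, rfl⟩
      · rintro ⟨a, ha, rfl⟩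
        exact ha
    refine ⟨M, ?_, (key M P hcov).mpr hP.deg, ncard_edgeSet_eq hpos M fun i j => ?_⟩
    · intro a ha
      obtain ⟨e, he, hx⟩ := ha
      obtain ⟨c, d, rfl⟩ := hends e he
      obtain ⟨b, hb⟩ : ∃ b, (pos c, pos d) = (pos a, pos b) ∨ (pos c, pos d) = (pos b, pos a) := by
        rcases hx with hx | hx
        · exact ⟨d, Or.inl (by rw [← hx])⟩
        · exact ⟨c, Or.inr (by rw [← hx])⟩
      refine ⟨b, by rcases hb with hb | hb <;> rw [hb] at he <;> [exact Or.inl he; exact Or.inr he],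
        ?_⟩
      rintro w (hw | hw)
      · have h1 := hP.matching _ he _ hw (pos a) hx (Or.inl rfl)
        have h2 := (hP.edge _ hw).1
        rw [h1] at hb
        simp only [Prod.mk.injEq] at h2 hb
        rcases hb with hb | hb
        · exact hpos hb.2
        · omega
      · have h1 := hP.matching _ he _ hw (pos a) hx (Or.inr rfl)
        have h2 := (hP.edge _ hw).1
        rw [h1] at hb
        simp only [Prod.mk.injEq] at h2 hb
        rcases hb with hb | hb
        · omega
        · exact hpos hb.1
    · constructor
      · intro h
        obtain ⟨a, b, he⟩ := hends _ h
        simp only [Prod.mk.injEq] at he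
        obtain ⟨rfl, rfl⟩ := he
        exact ⟨a, b, Or.inl h, (hP.edge _ h).1, rfl, rfl⟩
      · rintro ⟨a, b, h | h, hij, rfl, rfl⟩
        · exact h
        · have := (hP.edge _ h).1
          simp only at this
          omega

end Degenerate

/-! ### The elimination ordering -/

theorem mul_add_lt_mul_add {M a b a' b' : ℕ} (h : a < a') (hb : b < M) :
    a * M + b < a' * M + b' := by
  have := Nat.mul_le_mul_right M (Nat.succ_le_of_lt h)
  rw [Nat.succ_mul] at this
  omega

theorem mul_add_inj {M a b a' b' : ℕ} (hb : b < M) (hb' : b' < M)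
    (h : a * M + b = a' * M + b') : a = a' ∧ b = b' := by
  rcases lt_trichotomy a a' with h1 | rfl | h1
  · exact absurd h (mul_add_lt_mul_add h1 hb).ne
  · exact ⟨rfl, by omega⟩
  · exact absurd h (mul_add_lt_mul_add h1 hb').ne'

open Classical in
/-- The number of all `v` that are smaller than every witness for `P` is the least witness. -/
theorem card_filter_lt_witnesses {n : ℕ} {P : ℕ → Prop} (h : ∃ u < n, P u) :
    ∃ u < n, P u ∧ ∑ v ∈ Finset.range n, (if ∀ u < n, u ≤ v → ¬ P u then 1 else 0) = u := by
  obtain ⟨hlt, hP⟩ := Nat.find_spec h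
  refine ⟨Nat.find h, hlt, hP, ?_⟩
  rw [← Finset.card_filter]
  have : (Finset.range n).filter (fun v => ∀ u < n, u ≤ v → ¬ P u) =
      Finset.range (Nat.find h) := by
    ext v
    simp only [Finset.mem_filter, Finset.mem_range]
    constructor
    · rintro ⟨-, hv⟩
      by_contra hlt'
      exact hv _ hlt (by omega) hP
    · exact fun hv => ⟨by omega, fun u hu huv hPu => Nat.find_min h (by omega) ⟨hu, hPu⟩⟩
  rw [this, Finset.card_range]

/-- `u` is not among the first `t` vertices of the ordering `O`. -/
def Remaining (O : ℕ → ℕ) (t u : ℕ) : Prop := ∀ i < t, O i ≠ u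

/-- `u` is a simplicial vertex of the graph that remains of the graph `D` on `0, …, n - 1` when the
first `t` vertices of the ordering `O` have been removed. -/
def RemainingSimplicial (n : ℕ) (D : ℕ → ℕ → Prop) (O : ℕ → ℕ) (t u : ℕ) : Prop :=
  Remaining O t u ∧ ∀ x < n, ∀ y < n, D u x → D u y → x ≠ y → Remaining O t x → Remaining O t y →
    D x y

open Classical in
theorem IsChordal.order_spec {n : ℕ} {G : SimpleGraph (Fin n)} (hG : IsChordal G)
    {D : ℕ → ℕ → Prop} (hD : ∀ i j : Fin n, D i j ↔ G.Adj i j) {O : ℕ → ℕ}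
    (hO : ∀ t < n, O t = ∑ v ∈ Finset.range n,
      (if ∀ u < n, u ≤ v → ¬ RemainingSimplicial n D O t u then 1 else 0)) :
    ∀ t < n, O t < n ∧ RemainingSimplicial n D O t (O t) := by
  intro t ht
  have hne : (Finset.univ.filter fun x : Fin n => Remaining O t x).Nonempty := by
    by_contra h0
    rw [Finset.not_nonempty_iff_eq_empty, Finset.filter_eq_empty_iff] at h0
    have hsub : Finset.range n ⊆ (Finset.range t).image O := by
      intro x hx
      rw [Finset.mem_range] at hx
      have := h0 (Finset.mem_univ (⟨x, hx⟩ : Fin n))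
      simp only [Remaining, not_forall, not_not] at this
      obtain ⟨i, hi, hix⟩ := this
      exact Finset.mem_image.mpr ⟨i, Finset.mem_range.mpr hi, hix⟩
    have h1 := (Finset.card_le_card hsub).trans Finset.card_image_le
    rw [Finset.card_range, Finset.card_range] at h1
    omega
  obtain ⟨v, hv, hsimp⟩ := hG.exists_simplicial _ hne
  simp only [Finset.mem_filter, Finset.mem_univ, true_and] at hv hsimp
  have hex : ∃ u < n, RemainingSimplicial n D O t u := by
    refine ⟨v, v.2, hv, fun x hx y hy hvx hvy hxy hrx hry => ?_⟩
    rw [hD v ⟨x, hx⟩] at hvx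
    rw [hD v ⟨y, hy⟩] at hvy
    rw [hD ⟨x, hx⟩ ⟨y, hy⟩]
    exact hsimp ⟨x, hx⟩ hrx ⟨y, hy⟩ hry hvx hvy fun h => hxy (congrArg Fin.val h)
  obtain ⟨u, hu, hP, hsum⟩ := card_filter_lt_witnesses hex
  rw [hO t ht, hsum]
  exact ⟨hu, hP⟩

/-- An ordering by repeated removal of simplicial vertices is a perfect elimination ordering. -/
theorem exists_position {n : ℕ} {G : SimpleGraph (Fin n)} {D : ℕ → ℕ → Prop}
    (hD : ∀ i j : Fin n, D i j ↔ G.Adj i j) {O : ℕ → ℕ}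
    (hO : ∀ t < n, O t < n ∧ RemainingSimplicial n D O t (O t)) :
    ∃ pos : Fin n → ℕ, Function.Injective pos ∧ (∀ a, pos a < n) ∧
      IsPerfectElimination n (positionGraph G pos) ∧
      ∀ i j, positionGraph G pos i j ↔ i < n ∧ j < n ∧ D (O i) (O j) := by
  have hne : ∀ i j, i < j → j < n → O i ≠ O j := fun i j hij hj => (hO j hj).2.1 i hij
  have hinj : ∀ i j, i < n → j < n → O i = O j → i = j := by
    intro i j hi hj h
    rcases lt_trichotomy i j with h1 | h1 | h1
    · exact absurd h (hne i j h1 hj)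
    · exact h1
    · exact absurd h.symm (hne j i h1 hi)
  let f : Fin n → Fin n := fun i => ⟨O i, (hO i i.2).1⟩
  have hf : Function.Injective f := by
    intro i j h
    exact Fin.ext (hinj i j i.2 j.2 (congrArg Fin.val h))
  let e : Fin n ≃ Fin n := Equiv.ofBijective f (Finite.injective_iff_bijective.mp hf)
  have hiff : ∀ i j, positionGraph G (fun a => (e.symm a : ℕ)) i j ↔
      i < n ∧ j < n ∧ D (O i) (O j) := by
    intro i j
    constructor
    · rintro ⟨a, b, hab, rfl, rfl⟩
      refine ⟨(e.symm a).2, (e.symm b).2, (hD (f (e.symm a)) (f (e.symm b))).mpr ?_⟩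
      rw [show f (e.symm a) = a from e.apply_symm_apply a,
        show f (e.symm b) = b from e.apply_symm_apply b]
      exact hab
    · rintro ⟨hi, hj, h⟩
      refine ⟨f ⟨i, hi⟩, f ⟨j, hj⟩, (hD _ _).mp h, ?_, ?_⟩
      · exact congrArg Fin.val (e.symm_apply_apply ⟨i, hi⟩)
      · exact congrArg Fin.val (e.symm_apply_apply ⟨j, hj⟩)
  refine ⟨fun a => (e.symm a : ℕ), ?_, fun a => (e.symm a).2, ⟨?_, ?_, ?_, ?_⟩, hiff⟩
  · exact fun a b h => e.symm.injective (Fin.ext h)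
  · rintro i j ⟨a, b, hab, ha, hb⟩
    exact ⟨b, a, hab.symm, hb, ha⟩
  · rintro i ⟨a, b, hab, ha, hb⟩
    exact hab.ne (e.symm.injective (Fin.ext (ha.trans hb.symm)))
  · exact fun i j h => ((hiff i j).mp h).1
  · intro i j k hij hik hjk h h'
    rw [hiff] at h h' ⊢
    obtain ⟨hi, hj, h⟩ := h
    obtain ⟨-, hk, h'⟩ := h'
    refine ⟨hj, hk, (hO i hi).2.2 _ (hO j hj).1 _ (hO k hk).1 h h' ?_ ?_ ?_⟩
    · exact fun he => hjk (hinj j k hj hk he)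
    · exact fun l hl => hne l j (hl.trans hij) hj
    · exact fun l hl => hne l k (hl.trans hik) hk

/-! ### The program -/

namespace RAM

open RAM.Expr

/-- The arrays `A₀` and `A₁` hold the adjacency matrix and the elimination ordering, the cell
`A₂[s * B + x]` tells whether `x` is in the set with the code `s`, and `A₃` is the table of the
dynamic program. The variables `x₀`, `x₁`, `x₂`, `x₃` hold the number `n` of vertices, the base
`B = n + 2` of the codes of sets, the number `M` of these codes, and the number of the cells
of `A₃`; the variable `x₄` holds the index of the cell that is being computed. -/
structure Setting (n B M : ℕ) (ρ : ℕ → ℕ) : Prop where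
  var0 : ρ 0 = n
  var1 : ρ 1 = B
  var2 : ρ 2 = M

theorem Setting.update {n B M : ℕ} {ρ : ℕ → ℕ} (h : Setting n B M ρ) {i : ℕ} (hi : 3 ≤ i) (x : ℕ) :
    Setting n B M (Function.update ρ i x) := by
  refine ⟨?_, ?_, ?_⟩ <;> rw [Function.update_of_ne (by omega)]
  exacts [h.var0, h.var1, h.var2]

/-- `x_u` is not among the first `x₄` vertices of the ordering. -/
def remainingE (u : ℕ) : Expr :=
  all 9 0 (imp (lt (var 9) (var 4)) (not (eq (get 1 (var 9)) (var u))))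

/-- Adjacency of `x_i` and `x_j` in the input. -/
def adjE (i j : ℕ) : Expr := get 0 (add (mulv (var i) 0) (var j))

/-- `x₆` is a simplicial vertex of what remains after the removal of the first `x₄` vertices. -/
def simplicialE : Expr :=
  and (remainingE 6) (all 7 0 (all 8 0 (imp (adjE 6 7) (imp (adjE 6 8)
    (imp (not (eq (var 7) (var 8))) (imp (remainingE 7) (imp (remainingE 8) (adjE 7 8))))))))

/-- The vertex at the position `x₄` of the ordering: the least vertex that is simplicial in what
remains, computed as the number of all vertices that are smaller than every such vertex. -/
def orderE : Expr :=
  sum 5 0 (all 6 0 (imp (not (lt (var 5) (var 6))) (not simplicialE)))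

/-- The cell of `A₂` with index `x₄`. -/
def memberE : Expr :=
  ex 5 2 (ex 6 1 (ex 7 2 (ex 8 1 (and (eq (var 4) (add (mulv (var 5) 1) (var 6)))
    (and (eq (var 5) (add (mulv (var 7) 1) (var 8)))
      (or (eq (var 8) (add (var 6) (num 1))) (get 2 (add (mulv (var 7) 1) (var 6)))))))))

/-- Membership of `x_i` in the set with the code `x_s`. -/
def inE (i s : ℕ) : Expr := get 2 (add (mulv (var s) 1) (var i))

/-- Adjacency of the vertices at the positions `x_i` and `x_j`. -/
def edgeE (i j : ℕ) : Expr :=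
  and (lt (var i) (var 0)) (and (lt (var j) (var 0))
    (get 0 (add (mulv (get 1 (var i)) 0) (get 1 (var j)))))

/-- The index of the cell of `A₃` with the given coordinates. -/
def cellE (v p s t k : Expr) : Expr :=
  add (mulv (add (mulv (add (mulv (add (mulv v 2) p) 2) s) 2) t) 2) k

/-- `x_p` is the parent of `x_u`. -/
def parentE (u p : ℕ) : Expr :=
  and (or (eq (var p) (var 0)) (and (lt (var u) (var p)) (edgeE u p)))
    (and (not (lt (var 0) (var p)))
      (all 16 2 (imp (lt (var 16) (var p)) (imp (lt (var u) (var 16)) (not (edgeE u 16))))))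

/-- The relation `Combines`, where the variables are `u = 10`, `s = 7`, `t = 8`, `k = 9`, `t₁ = 11`,
`k₁ = 12`, `s₂ = 13`, `t₂ = 14`, `k₂ = 15`. -/
def combinesE : Expr :=
  and (all 16 1 (not (and (inE 16 11) (inE 16 14))))
  (or (and (all 16 1 (iff (inE 16 13) (and (inE 16 7) (and (lt (var 10) (var 16)) (edgeE 10 16)))))
        (and (all 16 1 (iff (inE 16 8) (or (inE 16 11) (inE 16 14))))
          (eq (var 9) (add (var 12) (var 15)))))
  (or (and (all 16 1 (iff (inE 16 13) (or (eq (var 16) (var 10))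
          (and (inE 16 7) (and (lt (var 10) (var 16)) (edgeE 10 16))))))
        (and (inE 10 14)
        (and (all 16 1 (iff (inE 16 8)
            (or (inE 16 11) (and (inE 16 14) (not (eq (var 16) (var 10)))))))
          (eq (var 9) (add (var 12) (var 15))))))
      (and (all 16 1 (iff (inE 16 13) (or (eq (var 16) (var 10))
          (and (inE 16 7) (and (lt (var 10) (var 16)) (edgeE 10 16))))))
        (and (not (inE 10 14))
          (ex 17 1 (and (inE 17 7) (and (lt (var 10) (var 17)) (and (edgeE 10 17)
            (and (not (inE 17 11)) (and (not (inE 17 14))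
            (and (all 16 1 (iff (inE 16 8)
                (or (inE 16 11) (or (inE 16 14) (eq (var 16) (var 17))))))
              (eq (var 9) (add (add (var 12) (var 15)) (num 1))))))))))))))

/-- The relation `TableStep`, where the variables are `v = 5`, `p = 6`, `s = 7`, `t = 8`, `k = 9`. -/
def stepE : Expr :=
  or (and (eq (var 5) (num 0)) (and (all 16 1 (not (inE 16 8))) (eq (var 9) (num 0))))
    (ex 10 2 (and (lt (var 10) (var 5)) (and (eq (var 5) (add (var 10) (num 1)))
      (or (and (not (parentE 10 6)) (get 3 (cellE (var 10) (var 6) (var 7) (var 8) (var 9))))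
        (and (parentE 10 6) (ex 11 2 (ex 12 2 (ex 13 2 (ex 14 2 (ex 15 2
          (and (get 3 (cellE (var 10) (var 6) (var 7) (var 11) (var 12)))
          (and (get 3 (cellE (var 10) (var 10) (var 13) (var 14) (var 15)))
            combinesE))))))))))))

/-- The cell of `A₃` with index `x₄`. -/
def tableE : Expr :=
  ex 5 2 (ex 6 2 (ex 7 2 (ex 8 2 (ex 9 2
    (and (eq (var 4) (cellE (var 5) (var 6) (var 7) (var 8) (var 9))) stepE)))))

/-- The maximum `k` for which the table shows a solution, computed as the number of all `k` that are
smaller than the size of some solution. The code of the empty set is `0`. The double negation turns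
the value of the formula into `0` or `1`. -/
def outputE : Expr :=
  sum 5 0 (not (not (ex 6 2 (and (lt (var 5) (var 6))
    (get 3 (cellE (var 0) (var 0) (num 0) (num 0) (var 6)))))))

/-- The `m`-th power of `x₁`. -/
def powE : ℕ → Expr
  | 0 => num 1
  | m + 1 => mulv (powE m) 1

/-- The program that computes the maximum size of an `r`-degenerate matching. -/
def matchingProg (r : ℕ) : Prog :=
  .seq (assign 1 (add (var 0) (num 2))) (.seq (assign 2 (powE (r + 1)))
  (.seq (assign 3 (mulv (mulv (mulv (mulv (var 2) 2) 2) 2) 2))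
  (.seq (tab 1 4 0 orderE) (.seq (tab 2 4 3 memberE) (.seq (tab 3 4 3 tableE)
    (assign 0 outputE))))))

/-- The index of a cell of the table. -/
def cell (M v p s t k : ℕ) : ℕ := (((v * M + p) * M + s) * M + t) * M + k

theorem cell_inj {M v p s t k v' p' s' t' k' : ℕ} (hp : p < M) (hs : s < M) (ht : t < M)
    (hk : k < M) (hp' : p' < M) (hs' : s' < M) (ht' : t' < M) (hk' : k' < M)
    (h : cell M v p s t k = cell M v' p' s' t' k') :
    v = v' ∧ p = p' ∧ s = s' ∧ t = t' ∧ k = k' := by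
  obtain ⟨h1, rfl⟩ := mul_add_inj hk hk' h
  obtain ⟨h2, rfl⟩ := mul_add_inj ht ht' h1
  obtain ⟨h3, rfl⟩ := mul_add_inj hs hs' h2
  obtain ⟨h4, rfl⟩ := mul_add_inj hp hp' h3
  exact ⟨h4, rfl, rfl, rfl, rfl⟩

theorem cell_lt_cell {M v p s t k v' p' s' t' k' : ℕ} (hv : v < v') (hp : p < M) (hs : s < M)
    (ht : t < M) (hk : k < M) : cell M v p s t k < cell M v' p' s' t' k' :=
  mul_add_lt_mul_add (mul_add_lt_mul_add (mul_add_lt_mul_add (mul_add_lt_mul_add hv hp) hs) ht) hk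

theorem cell_lt {M v p s t k : ℕ} (hv : v < M) (hp : p < M) (hs : s < M)
    (ht : t < M) (hk : k < M) : cell M v p s t k < M * M * M * M * M := by
  have := cell_lt_cell (v' := M) (p' := 0) (s' := 0) (t' := 0) (k' := 0) hv hp hs ht hk
  simpa [cell] using this

section Semantics

variable {n B M : ℕ} {ρ : ℕ → ℕ} {A : ℕ → ℕ → ℕ}

theorem eval_powE (m : ℕ) : (powE m).eval ρ A = ρ 1 ^ m := by
  induction m with
  | zero => rfl
  | succ m ih => rw [powE, eval, ih, pow_succ]

theorem eval_cellE (h : Setting n B M ρ) (v p s t k : Expr) :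
    (cellE v p s t k).eval ρ A =
      cell M (v.eval ρ A) (p.eval ρ A) (s.eval ρ A) (t.eval ρ A) (k.eval ρ A) := by
  simp only [cellE, eval, h.var2, cell]

theorem holds_edgeE (h : Setting n B M ρ) (i j : ℕ) :
    (edgeE i j).Holds ρ A ↔ ρ i < n ∧ ρ j < n ∧ A 0 (A 1 (ρ i) * n + A 1 (ρ j)) ≠ 0 := by
  simp only [edgeE, holds_and, holds_lt, holds_get, eval, h.var0]

theorem holds_inE (h : Setting n B M ρ) (i s : ℕ) :
    (inE i s).Holds ρ A ↔ A 2 (ρ s * B + ρ i) ≠ 0 := by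
  simp only [inE, holds_get, eval, h.var1]

theorem holds_parentE (h : Setting n B M ρ) {E : ℕ → ℕ → Prop}
    (hE : ∀ i j, E i j ↔ i < n ∧ j < n ∧ A 0 (A 1 i * n + A 1 j) ≠ 0) {u p : ℕ} (hu : u < 16)
    (hp : p < 16) (hpM : ρ p < M) :
    (parentE u p).Holds ρ A ↔ ρ p = parent n E (ρ u) := by
  rw [parent_eq_iff]
  have h16 : ∀ x, Setting n B M (Function.update ρ 16 x) := fun x => h.update (by omega) x
  simp only [parentE, holds_and, holds_or, holds_eq, holds_lt, holds_not, holds_all, holds_imp,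
    holds_edgeE h, holds_edgeE (h16 _), eval, h.var0, h.var2, Function.update_self,
    Function.update_of_ne hu.ne, Function.update_of_ne hp.ne, ← hE, not_lt]
  refine and_congr_right fun _ => and_congr_right fun _ => ?_
  exact ⟨fun g q hq => g q (by omega) hq, fun g q _ hq => g q hq⟩

theorem eval_orderE_cut {D : ℕ → ℕ → Prop} (hD : ∀ x y, D x y ↔ A 0 (x * n + y) ≠ 0)
    (h : ρ 0 = n) {t : ℕ} (ht : t < n) :
    open Classical in orderE.eval (Function.update ρ 4 t) (cut A 1 t) =
      ∑ v ∈ Finset.range n,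
        (if ∀ u < n, u ≤ v → ¬ RemainingSimplicial n D (A 1) t u then 1 else 0) := by
  have hrem : ∀ (σ : ℕ → ℕ) (u : ℕ), u ≠ 9 → σ 0 = n → σ 4 = t →
      ((remainingE u).Holds σ (cut A 1 t) ↔ Remaining (A 1) t (σ u)) := by
    intro σ u hu h0 h4
    simp only [remainingE, holds_all, holds_imp, holds_lt, holds_not, holds_eq, eval, h0,
      Function.update_self, Function.update_of_ne hu, Function.update_of_ne (show 4 ≠ 9 by omega),
      h4, Remaining]
    constructor
    · intro g i hi
      have := g i (by omega) hi
      rwa [cut, if_neg (by omega)] at this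
    · intro g i _ hi
      rw [cut, if_neg (by omega)]
      exact g i hi
  have hadj : ∀ (σ : ℕ → ℕ) (i j : ℕ), σ 0 = n →
      ((adjE i j).Holds σ (cut A 1 t) ↔ D (σ i) (σ j)) := by
    intro σ i j h0
    simp [adjE, holds_get, eval, h0, cut, hD]
  have hsimp : ∀ (σ : ℕ → ℕ), σ 0 = n → σ 4 = t →
      (simplicialE.Holds σ (cut A 1 t) ↔ RemainingSimplicial n D (A 1) t (σ 6)) := by
    intro σ h0 h4
    have h0' : ∀ x y, Function.update (Function.update σ 7 x) 8 y 0 = n := fun x y => h0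
    have h4' : ∀ x y, Function.update (Function.update σ 7 x) 8 y 4 = t := fun x y => h4
    have h6' : ∀ x y, Function.update (Function.update σ 7 x) 8 y 6 = σ 6 := fun x y => rfl
    have h7' : ∀ x y, Function.update (Function.update σ 7 x) 8 y 7 = x := fun x y => rfl
    have h8' : ∀ x y, Function.update (Function.update σ 7 x) 8 y 8 = y := fun x y => rfl
    have h0'' : ∀ x, Function.update σ 7 x 0 = n := fun x => h0
    simp only [simplicialE, holds_and, holds_all, holds_imp, holds_not, holds_eq, eval,
      hrem σ 6 (by omega) h0 h4, hrem _ 7 (by omega) (h0' _ _) (h4' _ _),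
      hrem _ 8 (by omega) (h0' _ _) (h4' _ _), hadj _ _ _ (h0' _ _), h0, h0'', h6', h7', h8',
      RemainingSimplicial, ne_eq]
  have h0' : ∀ x, Function.update (Function.update ρ 4 t) 5 x 0 = n := fun x => h
  have h0'' : ∀ x y, Function.update (Function.update (Function.update ρ 4 t) 5 x) 6 y 0 = n :=
    fun x y => h
  have h4'' : ∀ x y, Function.update (Function.update (Function.update ρ 4 t) 5 x) 6 y 4 = t :=
    fun x y => rfl
  have h5'' : ∀ x y, Function.update (Function.update (Function.update ρ 4 t) 5 x) 6 y 5 = x :=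
    fun x y => rfl
  have h6'' : ∀ x y, Function.update (Function.update (Function.update ρ 4 t) 5 x) 6 y 6 = y :=
    fun x y => rfl
  have hn : Function.update ρ 4 t 0 = n := h
  classical
  simp only [orderE, eval, eval_all, hn]
  refine Finset.sum_congr rfl fun v _ => if_congr ?_ rfl rfl
  simp only [holds_imp, holds_not, holds_lt, eval, h0', h5'', h6'', hsimp _ (h0'' _ _) (h4'' _ _),
    not_lt]

/-- The cells of `A₂` describe the coded sets. -/
theorem member_table (h : Setting n B M ρ) (hB : 2 ≤ B)
    (hA : ∀ c < ρ 3, A 2 c = memberE.eval (Function.update ρ 4 c) (cut A 2 c))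
    (hM : M * B ≤ ρ 3) : ∀ s < M, ∀ x < B, A 2 (s * B + x) ≠ 0 ↔ x ∈ codedSet B s := by
  -- For `s = 0`, the cell refers to itself, and `cut` makes it empty.
  have key : ∀ s < M, ∀ x < B, A 2 (s * B + x) ≠ 0 ↔
      s % B = x + 1 ∨ cut A 2 (s * B + x) 2 (s / B * B + x) ≠ 0 := by
    intro s hs x hx
    have hc : s * B + x < ρ 3 := by
      have := mul_add_lt_mul_add (b' := 0) hs hx
      omega
    have hsB : s / B * B + s % B = s := by rw [mul_comm]; exact Nat.div_add_mod s B
    rw [hA _ hc]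
    change memberE.Holds _ _ ↔ _
    have e1 : ∀ a b c d e i, i < 5 → Function.update (Function.update (Function.update
      (Function.update (Function.update ρ 4 a) 5 b) 6 c) 7 d) 8 e i = Function.update ρ 4 a i := by
      intro a b c d e i hi
      rw [Function.update_of_ne, Function.update_of_ne, Function.update_of_ne,
        Function.update_of_ne] <;> omega
    simp only [memberE, holds_ex, holds_and, holds_eq, holds_or, holds_get, eval,
      Function.update_apply]
    simp only [Nat.reduceEqDiff, reduceIte, h.var1, h.var2,
      OfNat.one_ne_ofNat]
    constructor
    · rintro ⟨s', hs', x', hx', e, he, d, hd, h1, h2, h3⟩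
      obtain ⟨rfl, rfl⟩ := mul_add_inj hx hx' h1
      have h4 : s / B * B + s % B = e * B + d := hsB.trans h2
      obtain ⟨h5, h6⟩ := mul_add_inj (Nat.mod_lt _ (by omega)) hd h4
      rw [h5, h6]
      exact h3
    · intro h3
      exact ⟨s, hs, x, hx, s / B, (Nat.div_le_self _ _).trans_lt hs, s % B,
        Nat.mod_lt _ (by omega), rfl, hsB.symm, h3⟩
  intro s
  induction s using Nat.strong_induction_on with
  | _ s ih =>
    intro hs x hx
    rw [key s hs x hx, mem_codedSet_iff hB]
    rcases Nat.eq_zero_or_pos s with rfl | hpos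
    · simp [cut]
    · have hlt : s / B < s := Nat.div_lt_self hpos (by omega)
      rw [cut, if_neg, ih _ hlt (hlt.trans hs) x hx]
      · simp [hpos.ne']
      · have := mul_add_lt_mul_add (b' := x) hlt hx
        omega

theorem holds_all_iff (h : Setting n B M ρ) {i : ℕ} {e : Expr} {p : ℕ → Prop}
    (he : ∀ x < B, (e.Holds (Function.update ρ i x) A ↔ p x)) (hp : ∀ x, B ≤ x → p x) :
    (all i 1 e).Holds ρ A ↔ ∀ x, p x := by
  rw [holds_all, h.var1]
  constructor
  · intro g x
    rcases lt_or_ge x B with hx | hx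
    · exact (he x hx).mp (g x hx)
    · exact hp x hx
  · exact fun g x hx => (he x hx).mpr (g x)

theorem holds_combinesE (h : Setting n B M ρ) (hB : 2 ≤ B) {E : ℕ → ℕ → Prop}
    (hE : ∀ i j, E i j ↔ i < n ∧ j < n ∧ A 0 (A 1 i * n + A 1 j) ≠ 0)
    (hmem : ∀ s < M, ∀ x < B, A 2 (s * B + x) ≠ 0 ↔ x ∈ codedSet B s) (hu : ρ 10 < B)
    (hs : ρ 7 < M) (ht : ρ 8 < M) (ht₁ : ρ 11 < M) (hs₂ : ρ 13 < M) (ht₂ : ρ 14 < M) :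
    combinesE.Holds ρ A ↔ Combines E (ρ 10) (codedSet B (ρ 7)) (codedSet B (ρ 8)) (ρ 9)
      (codedSet B (ρ 11)) (ρ 12) (codedSet B (ρ 13)) (codedSet B (ρ 14)) (ρ 15) := by
  have hin : ∀ {τ : ℕ → ℕ} (i s : ℕ), Setting n B M τ → τ s < M → τ i < B →
      ((inE i s).Holds τ A ↔ τ i ∈ codedSet B (τ s)) := by
    intro τ i s hτ hsM hiB
    rw [holds_inE hτ, hmem _ hsM _ hiB]
  have hedge : ∀ {τ : ℕ → ℕ} (i j : ℕ), Setting n B M τ →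
      ((edgeE i j).Holds τ A ↔ E (τ i) (τ j)) := fun i j hτ => by rw [holds_edgeE hτ, hE]
  have hbig : ∀ x, B ≤ x → ∀ s, x ∉ codedSet B s := fun x hx s hxs => by
    have := lt_of_mem_codedSet hB hxs
    omega
  have h16 : ∀ x, Setting n B M (Function.update ρ 16 x) := fun x => h.update (by omega) x
  have h17 : ∀ x, Setting n B M (Function.update ρ 17 x) := fun x => h.update (by omega) x
  have hset : (all 16 1 (iff (inE 16 13) (or (eq (var 16) (var 10))
      (and (inE 16 7) (and (lt (var 10) (var 16)) (edgeE 10 16)))))).Holds ρ A ↔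
      ∀ x, x ∈ codedSet B (ρ 13) ↔ x = ρ 10 ∨ x ∈ codedSet B (ρ 7) ∧ ρ 10 < x ∧ E (ρ 10) x := by
    refine holds_all_iff h (fun x hx => ?_) fun x hx => ?_
    · rw [holds_iff, holds_or, holds_and, holds_and, holds_lt, holds_eq,
        hin 16 13 (h16 x) hs₂ hx, hin 16 7 (h16 x) hs hx, hedge 10 16 (h16 x)]
      rfl
    · have h1 := hbig x hx (ρ 13)
      have h2 := hbig x hx (ρ 7)
      have h3 : x ≠ ρ 10 := by omega
      tauto
  rw [combinesE, holds_and, holds_or, holds_or, holds_and, holds_and, holds_and, holds_and,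
    holds_and, holds_and, holds_and, hset, holds_eq, holds_not, hin 10 14 h ht₂ hu, Combines]
  refine and_congr ?_ (or_congr ?_ (or_congr ?_ ?_))
  · refine holds_all_iff h (fun x hx => ?_) fun x hx => ?_
    · rw [holds_not, holds_and, hin 16 11 (h16 x) ht₁ hx, hin 16 14 (h16 x) ht₂ hx]
      rfl
    · exact fun hx' => hbig x hx _ hx'.1
  · refine and_congr ?_ (and_congr ?_ Iff.rfl)
    · refine holds_all_iff h (fun x hx => ?_) fun x hx => ?_
      · rw [holds_iff, holds_and, holds_and, holds_lt,
          hin 16 13 (h16 x) hs₂ hx, hin 16 7 (h16 x) hs hx, hedge 10 16 (h16 x)]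
        rfl
      · have h1 := hbig x hx (ρ 13)
        have h2 := hbig x hx (ρ 7)
        tauto
    · refine holds_all_iff h (fun x hx => ?_) fun x hx => ?_
      · rw [holds_iff, holds_or, hin 16 8 (h16 x) ht hx, hin 16 11 (h16 x) ht₁ hx,
          hin 16 14 (h16 x) ht₂ hx]
        rfl
      · have h1 := hbig x hx (ρ 8)
        have h2 := hbig x hx (ρ 11)
        have h3 := hbig x hx (ρ 14)
        tauto
  · refine and_congr Iff.rfl (and_congr Iff.rfl (and_congr ?_ Iff.rfl))
    refine holds_all_iff h (fun x hx => ?_) fun x hx => ?_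
    · rw [holds_iff, holds_or, holds_and, holds_not, holds_eq, hin 16 8 (h16 x) ht hx,
        hin 16 11 (h16 x) ht₁ hx, hin 16 14 (h16 x) ht₂ hx]
      rfl
    · have h1 := hbig x hx (ρ 8)
      have h2 := hbig x hx (ρ 11)
      have h3 := hbig x hx (ρ 14)
      tauto
  · refine and_congr Iff.rfl (and_congr Iff.rfl ?_)
    rw [holds_ex, h.var1]
    have hw : ∀ w < B, ((and (inE 17 7) (and (lt (var 10) (var 17)) (and (edgeE 10 17)
            (and (not (inE 17 11)) (and (not (inE 17 14))
            (and (all 16 1 (iff (inE 16 8)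
                (or (inE 16 11) (or (inE 16 14) (eq (var 16) (var 17))))))
              (eq (var 9) (add (add (var 12) (var 15)) (num 1))))))))).Holds
              (Function.update ρ 17 w) A ↔
        w ∈ codedSet B (ρ 7) ∧ ρ 10 < w ∧ E (ρ 10) w ∧ w ∉ codedSet B (ρ 11) ∧
          w ∉ codedSet B (ρ 14) ∧ (∀ x, x ∈ codedSet B (ρ 8) ↔ x ∈ codedSet B (ρ 11) ∨
            x ∈ codedSet B (ρ 14) ∨ x = w) ∧ ρ 9 = ρ 12 + ρ 15 + 1) := by
      intro w hw
      rw [holds_and, holds_and, holds_and, holds_and, holds_and, holds_and, holds_not, holds_not,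
        holds_lt, holds_eq, hin 17 7 (h17 w) hs hw, hin 17 11 (h17 w) ht₁ hw,
        hin 17 14 (h17 w) ht₂ hw, hedge 10 17 (h17 w)]
      refine and_congr Iff.rfl (and_congr Iff.rfl (and_congr Iff.rfl (and_congr Iff.rfl
        (and_congr Iff.rfl (and_congr ?_ Iff.rfl)))))
      refine holds_all_iff (h17 w) (fun x hx => ?_) fun x hx => ?_
      · have hs' : Setting n B M (Function.update (Function.update ρ 17 w) 16 x) :=
          (h17 w).update (by omega) x
        rw [holds_iff, holds_or, holds_or, holds_eq, hin 16 8 hs' ht hx, hin 16 11 hs' ht₁ hx,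
          hin 16 14 hs' ht₂ hx]
        rfl
      · have h1 := hbig x hx (ρ 8)
        have h2 := hbig x hx (ρ 11)
        have h3 := hbig x hx (ρ 14)
        have h4 : x ≠ w := by omega
        tauto
    constructor
    · rintro ⟨w, hwB, g⟩
      exact ⟨w, (hw w hwB).mp g⟩
    · rintro ⟨w, g⟩
      have hwB : w < B := by
        have := lt_of_mem_codedSet hB g.1
        omega
      exact ⟨w, hwB, (hw w hwB).mpr g⟩

theorem Setting.holds_ex_iff (h : Setting n B M ρ) {i : ℕ} {e : Expr} {p : ℕ → Prop}
    (he : ∀ x < M, (e.Holds (Function.update ρ i x) A ↔ p x)) :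
    (ex i 2 e).Holds ρ A ↔ ∃ x < M, p x := by
  rw [holds_ex, h.var2]
  exact exists_congr fun x => and_congr_right fun hx => he x hx

theorem holds_stepE (h : Setting n B M ρ) (hB : 2 ≤ B) (hnB : n ≤ B) {E : ℕ → ℕ → Prop}
    (hE : ∀ i j, E i j ↔ i < n ∧ j < n ∧ A 0 (A 1 i * n + A 1 j) ≠ 0)
    (hmem : ∀ s < M, ∀ x < B, A 2 (s * B + x) ≠ 0 ↔ x ∈ codedSet B s)
    (hv : ρ 5 ≤ n) (hvM : ρ 5 ≤ M) (hp : ρ 6 < M) (hs : ρ 7 < M) (ht : ρ 8 < M) :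
    stepE.Holds ρ A ↔ TableStep n E (codedSet B) M (fun v p s t k => A 3 (cell M v p s t k) ≠ 0)
      (ρ 5) (ρ 6) (ρ 7) (ρ 8) (ρ 9) := by
  rw [stepE, holds_or, holds_and, holds_and, holds_eq, holds_eq, TableStep]
  refine or_congr (and_congr Iff.rfl (and_congr ?_ Iff.rfl)) ?_
  · rw [Set.eq_empty_iff_forall_notMem]
    refine holds_all_iff h (fun x hx => ?_) fun x hx hxt => ?_
    · rw [holds_not, holds_inE (h.update (by omega) x)]
      exact not_congr (hmem _ ht x hx)
    · have := lt_of_mem_codedSet hB hxt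
      omega
  · refine (h.holds_ex_iff (p := fun u => u < ρ 5 ∧ ρ 5 = u + 1 ∧
      ((ρ 6 ≠ parent n E u ∧ A 3 (cell M u (ρ 6) (ρ 7) (ρ 8) (ρ 9)) ≠ 0) ∨
       (ρ 6 = parent n E u ∧ ∃ t₁ < M, ∃ k₁ < M, ∃ s₂ < M, ∃ t₂ < M, ∃ k₂ < M,
        A 3 (cell M u (ρ 6) (ρ 7) t₁ k₁) ≠ 0 ∧ A 3 (cell M u u s₂ t₂ k₂) ≠ 0 ∧
        Combines E u (codedSet B (ρ 7)) (codedSet B (ρ 8)) (ρ 9) (codedSet B t₁) k₁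
          (codedSet B s₂) (codedSet B t₂) k₂))) fun u hu => ?_).trans ?_
    · have hσ := h.update (show 3 ≤ 10 by omega) u
      rw [holds_and, holds_and, holds_or, holds_and, holds_and, holds_not, holds_lt, holds_eq,
        holds_parentE (u := 10) (p := 6) hσ hE (by omega) (by omega) hp, holds_get, eval_cellE hσ]
      refine and_congr_right fun hu5 => and_congr_right fun hu1 => or_congr Iff.rfl
        (and_congr_right fun hpar => ?_)
      have huB : u < B := by
        have : u < ρ 5 := hu5
        omega
      refine hσ.holds_ex_iff fun t₁ ht₁ => ?_
      have h1 := hσ.update (show 3 ≤ 11 by omega) t₁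
      refine h1.holds_ex_iff fun k₁ hk₁ => ?_
      have h2 := h1.update (show 3 ≤ 12 by omega) k₁
      refine h2.holds_ex_iff fun s₂ hs₂ => ?_
      have h3 := h2.update (show 3 ≤ 13 by omega) s₂
      refine h3.holds_ex_iff fun t₂ ht₂ => ?_
      have h4 := h3.update (show 3 ≤ 14 by omega) t₂
      refine h4.holds_ex_iff fun k₂ hk₂ => ?_
      have h5 := h4.update (show 3 ≤ 15 by omega) k₂
      rw [holds_and, holds_and, holds_get, holds_get, eval_cellE h5, eval_cellE h5,
        holds_combinesE h5 hB hE hmem huB hs ht ht₁ hs₂ ht₂]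
      rfl
    · constructor
      · rintro ⟨u, -, hu, g⟩
        exact ⟨u, hu, g⟩
      · rintro ⟨u, hu, g⟩
        exact ⟨u, by omega, hu, g⟩

/-- The cells of `A₃` obey the recursion of the dynamic program. -/
theorem table_step (h : Setting n B M ρ) (hn : n + 2 ≤ B) (hBM : B ≤ M) {E : ℕ → ℕ → Prop}
    (hE : ∀ i j, E i j ↔ i < n ∧ j < n ∧ A 0 (A 1 i * n + A 1 j) ≠ 0)
    (hmem : ∀ s < M, ∀ x < B, A 2 (s * B + x) ≠ 0 ↔ x ∈ codedSet B s)
    (hL : ρ 3 = M * M * M * M * M)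
    (hA : ∀ c < ρ 3, A 3 c = tableE.eval (Function.update ρ 4 c) (cut A 3 c))
    {v p s t k : ℕ} (hv : v ≤ n) (hp : p ≤ n) (hs : s < M) (ht : t < M) (hk : k < M) :
    A 3 (cell M v p s t k) ≠ 0 ↔
      TableStep n E (codedSet B) M (fun v p s t k => A 3 (cell M v p s t k) ≠ 0) v p s t k := by
  set c := cell M v p s t k with hc
  have hcL : c < ρ 3 := by
    rw [hL]
    exact cell_lt (by omega) (by omega) hs ht hk
  rw [hA c hcL]
  change tableE.Holds _ _ ↔ _
  set A' := cut A 3 c with hA'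
  have hcut : ∀ b, b ≠ 3 → A' b = A b := by
    intro b hb
    funext y
    rw [hA', cut, if_neg fun h => hb h.1]
  have hE' : ∀ i j, E i j ↔ i < n ∧ j < n ∧ A' 0 (A' 1 i * n + A' 1 j) ≠ 0 := by
    rw [hcut 0 (by omega), hcut 1 (by omega)]
    exact hE
  have hmem' : ∀ s < M, ∀ x < B, A' 2 (s * B + x) ≠ 0 ↔ x ∈ codedSet B s := by
    rw [hcut 2 (by omega)]
    exact hmem
  have hprev : ∀ u q s t k, u < v → q < M → s < M → t < M → k < M →
      A' 3 (cell M u q s t k) = A 3 (cell M u q s t k) := by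
    intro u q s' t' k' hu hq hs' ht' hk'
    rw [hA', cut, if_neg]
    have := cell_lt_cell (v' := v) (p' := p) (s' := s) (t' := t) (k' := k) hu hq hs' ht' hk'
    omega
  have hrec : tableE.Holds (Function.update ρ 4 c) A' ↔
      TableStep n E (codedSet B) M (fun v p s t k => A' 3 (cell M v p s t k) ≠ 0) v p s t k := by
    have h0 := h.update (show 3 ≤ 4 by omega) c
    rw [tableE, h0.holds_ex_iff fun v' hv' => (h0.update (show 3 ≤ 5 by omega) v').holds_ex_iff
      fun p' hp' => ((h0.update (show 3 ≤ 5 by omega) v').update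
        (show 3 ≤ 6 by omega) p').holds_ex_iff
      fun s' hs' => (((h0.update (show 3 ≤ 5 by omega) v').update
        (show 3 ≤ 6 by omega) p').update (show 3 ≤ 7 by omega) s').holds_ex_iff
      fun t' ht' => ((((h0.update (show 3 ≤ 5 by omega) v').update
        (show 3 ≤ 6 by omega) p').update (show 3 ≤ 7 by omega) s').update
          (show 3 ≤ 8 by omega) t').holds_ex_iff fun k' hk' => Iff.rfl]
    have hσ : ∀ v' p' s' t' k', Setting n B M (Function.update (Function.update (Function.update
        (Function.update (Function.update (Function.update ρ 4 c) 5 v') 6 p') 7 s') 8 t') 9 k') :=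
      fun v' p' s' t' k' => ((((h0.update (show 3 ≤ 5 by omega) v').update
        (show 3 ≤ 6 by omega) p').update (show 3 ≤ 7 by omega) s').update
          (show 3 ≤ 8 by omega) t').update (show 3 ≤ 9 by omega) k'
    constructor
    · rintro ⟨v', hv', p', hp', s', hs', t', ht', k', hk', g⟩
      rw [holds_and, holds_eq, eval_cellE (hσ _ _ _ _ _)] at g
      obtain ⟨g1, g2⟩ := g
      have g1' : cell M v p s t k = cell M v' p' s' t' k' := g1
      obtain ⟨rfl, rfl, rfl, rfl, rfl⟩ := cell_inj (by omega) hs ht hk hp' hs' ht' hk' g1'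
      exact (holds_stepE (hσ v p s t k) (by omega) (by omega) hE' hmem' hv
        (show v ≤ M by omega) hp' hs' ht').mp g2
    · intro g
      refine ⟨v, by omega, p, by omega, s, hs, t, ht, k, hk, ?_⟩
      rw [holds_and, holds_eq, eval_cellE (hσ _ _ _ _ _)]
      exact ⟨rfl, (holds_stepE (hσ v p s t k) (by omega) (by omega) hE' hmem' hv
        (show v ≤ M by omega) (show p < M by omega) hs ht).mpr g⟩
  rw [hrec]
  refine or_congr Iff.rfl (exists_congr fun u => and_congr_right fun hu => and_congr_right fun _ =>
    or_congr (and_congr_right fun _ => ?_) (and_congr_right fun _ => ?_))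
  · beta_reduce
    rw [hprev u p s t k hu (by omega) hs ht hk]
  · refine exists_congr fun t₁ => and_congr_right fun ht₁ => exists_congr fun k₁ =>
      and_congr_right fun hk₁ => exists_congr fun s₂ => and_congr_right fun hs₂ =>
      exists_congr fun t₂ => and_congr_right fun ht₂ => exists_congr fun k₂ =>
      and_congr_right fun hk₂ => ?_
    beta_reduce
    rw [hprev u p s t₁ k₁ hu (by omega) hs ht₁ hk₁, hprev u u s₂ t₂ k₂ hu (by omega) hs₂ ht₂ hk₂]

end Semantics

end RAM

/-! ### Correctness and running time -/

theorem Feasible.le_card {E : ℕ → ℕ → Prop} {r n k : ℕ} {S T : Set ℕ}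
    (h : Feasible E r {u | u < n} S T k) : k ≤ n := by
  obtain ⟨M, hM, rfl⟩ := h
  rw [← Finset.card_range n]
  refine Finset.card_le_card_of_injOn Prod.fst (fun e he => ?_) fun e he e' he' heq => ?_
  · exact Finset.mem_coe.mpr (Finset.mem_range.mpr (hM.low e he).1)
  · exact hM.matching e he e' he' e.1 (Or.inl rfl) (Or.inl heq.symm)

open Classical in
theorem isGreatest_sum {n M : ℕ} {D : Set ℕ} (hD : D.Nonempty) (hn : ∀ k ∈ D, k ≤ n) (hM : n < M) :
    IsGreatest D (∑ k ∈ Finset.range n, if ∃ l < M, k < l ∧ l ∈ D then 1 else 0) := by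
  obtain ⟨m, hm, hmax⟩ : ∃ m, m ∈ D ∧ ∀ l ∈ D, l ≤ m :=
    ⟨sSup D, Nat.sSup_mem hD ⟨n, hn⟩, fun l hl => le_csSup ⟨n, hn⟩ hl⟩
  have hfilter : (Finset.range n).filter (fun k => ∃ l < M, k < l ∧ l ∈ D) = Finset.range m := by
    ext k
    simp only [Finset.mem_filter, Finset.mem_range]
    have hmn := hn m hm
    constructor
    · rintro ⟨-, l, -, hkl, hl⟩
      exact hkl.trans_le (hmax l hl)
    · exact fun hk => ⟨by omega, m, by omega, hk, hm⟩
  rw [← Finset.card_filter, hfilter, Finset.card_range]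
  exact ⟨hm, fun l hl => hmax l hl⟩

namespace RAM

open RAM.Expr

open Classical in
theorem eval_outputE {n B M : ℕ} {ρ : ℕ → ℕ} {A : ℕ → ℕ → ℕ} (h : Setting n B M ρ) :
    outputE.eval ρ A = ∑ k ∈ Finset.range n,
      if ∃ l < M, k < l ∧ A 3 (cell M n n 0 0 l) ≠ 0 then 1 else 0 := by
  simp only [outputE, eval, h.var0]
  refine Finset.sum_congr rfl fun k _ => ?_
  have h5 := h.update (show 3 ≤ 5 by omega) k
  have hex : (ex 6 2 (and (lt (var 5) (var 6)) (get 3 (cellE (var 0) (var 0) (num 0) (num 0)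
      (var 6))))).Holds (Function.update ρ 5 k) A ↔
      ∃ l < M, k < l ∧ A 3 (cell M n n 0 0 l) ≠ 0 := by
    refine h5.holds_ex_iff fun l hl => ?_
    have h6 := h5.update (show 3 ≤ 6 by omega) l
    rw [holds_and, holds_lt, holds_get, eval_cellE h6]
    simp only [eval, h6.var0]
    rfl
  rw [eval_not, holds_not, hex]
  split_ifs <;> tauto

theorem graphInput_adj {n : ℕ} (G : SimpleGraph (Fin n)) (i j : Fin n) :
    (graphInput G).arr 0 (i * n + j) ≠ 0 ↔ G.Adj i j := by
  simp only [graphInput, true_and, ne_eq, ite_eq_right_iff, one_ne_zero, imp_false, not_not]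
  constructor
  · rintro ⟨i', j', h, heq⟩
    obtain ⟨h1, h2⟩ := mul_add_inj j.2 j'.2 heq
    rwa [Fin.ext h1, Fin.ext h2]
  · exact fun h => ⟨i, j, h, rfl⟩

/-- If the arrays and variables obey the recursions that the program solves, then its output is the
maximum size of an `r`-degenerate matching. Here, `A₁`, `A₂` and `A` are the contents of the arrays
after the computation of the ordering, of the coded sets, and of the table. -/
theorem isGreatest_outputE {n r : ℕ} {G : SimpleGraph (Fin n)} (hG : IsChordal G) {ρ : ℕ → ℕ}
    {A₁ A₂ A : ℕ → ℕ → ℕ} (h : Setting n (n + 2) ((n + 2) ^ (r + 1)) ρ)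
    (h3 : ρ 3 = (n + 2) ^ (r + 1) * (n + 2) ^ (r + 1) * (n + 2) ^ (r + 1) * (n + 2) ^ (r + 1) *
      (n + 2) ^ (r + 1))
    (hA0 : A 0 = (graphInput G).arr 0) (h10 : A₁ 0 = A 0) (h11 : A₁ 1 = A 1) (h22 : A₂ 2 = A 2)
    (hA1 : ∀ t < ρ 0, A₁ 1 t = orderE.eval (Function.update ρ 4 t) (cut A₁ 1 t))
    (hA2 : ∀ c < ρ 3, A₂ 2 c = memberE.eval (Function.update ρ 4 c) (cut A₂ 2 c))
    (hA3 : ∀ c < ρ 3, A 3 c = tableE.eval (Function.update ρ 4 c) (cut A 3 c)) :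
    IsGreatest (degenerateMatchingSizes G r) (outputE.eval ρ A) := by
  classical
  set B := n + 2 with hBdef
  set M := B ^ (r + 1) with hMdef
  have hB : 2 ≤ B := by omega
  have hBM : B ≤ M := by
    rw [hMdef, pow_succ]
    exact Nat.le_mul_of_pos_left B (Nat.pow_pos (by omega))
  have hD : ∀ i j : Fin n, A 0 ((i : ℕ) * n + j) ≠ 0 ↔ G.Adj i j := by
    intro i j
    rw [hA0, graphInput_adj]
  rw [h.var0] at hA1
  have hO := hG.order_spec (D := fun x y => A 0 (x * n + y) ≠ 0) hD (O := A 1) fun t ht => by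
    rw [← h11, hA1 t ht, eval_orderE_cut (fun _ _ => by rw [h10]) h.var0 ht]
  obtain ⟨pos, hinj, hlt, hpeo, hE⟩ := exists_position hD hO
  have hmem := member_table h hB hA2 (by
    rw [h3, mul_assoc]
    calc M * B ≤ M * M := Nat.mul_le_mul_left M hBM
      _ ≤ M * M * M * (M * M) := Nat.le_mul_of_pos_left _ (by positivity))
  rw [h22] at hmem
  have hcell := hpeo.table_iff (r := r) (M := M) (mem := codedSet B)
    (F := fun v p s t k => A 3 (cell M v p s t k) ≠ 0)
    (fun s hs => ⟨by exact_mod_cast encard_codedSet_le hB hs, fun x hx => by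
      have := lt_of_mem_codedSet hB hx
      omega⟩)
    (fun S hS hSn => exists_codedSet_eq hB (by exact_mod_cast hS) fun x hx => by
      have := hSn x hx
      omega)
    (fun v p s t k hv hp hs ht hk => table_step h le_rfl hBM hE hmem h3 hA3 hv hp hs ht hk)
    n le_rfl n le_rfl le_rfl 0 (by omega) 0 (by omega)
  have hset : ∀ k < M, (A 3 (cell M n n 0 0 k) ≠ 0 ↔ k ∈ degenerateMatchingSizes G r) := by
    intro k hk
    rw [mem_degenerateMatchingSizes_iff hinj hlt hpeo, hcell k hk (by simp [codedSet_zero]),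
      region_root, codedSet_zero]
  have hbound : ∀ k ∈ degenerateMatchingSizes G r, k ≤ n := fun k hk =>
    ((mem_degenerateMatchingSizes_iff hinj hlt hpeo r k).mp hk).le_card
  have hne : (degenerateMatchingSizes G r).Nonempty := by
    refine ⟨0, (mem_degenerateMatchingSizes_iff hinj hlt hpeo r 0).mpr
      ⟨∅, ⟨by simp, by simp, by simp, by simp, ?_⟩, rfl⟩⟩
    rintro x - ⟨e, he, -⟩
    exact absurd he (Finset.notMem_empty e)
  have hgreat := isGreatest_sum hne hbound (show n < M by omega)
  rw [eval_outputE h]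
  convert hgreat using 3 with k
  exact exists_congr fun l => and_congr_right fun hl => and_congr_right fun _ => hset l hl

/-- A bound for the running time of the program, as a polynomial in the number of the cells of the
table. -/
noncomputable def matchingCost (r : ℕ) : Polynomial ℕ :=
  assignCost (add (var 0) (num 2)) + (assignCost (powE (r + 1)) +
    (assignCost (mulv (mulv (mulv (mulv (var 2) 2) 2) 2) 2) +
    (tabCost orderE + (tabCost memberE + (tabCost tableE + assignCost outputE)))))

theorem Exec.seq_bounded {p p' : Prog} {s s' s'' : State} {c c' : Polynomial ℕ} {N : ℕ}
    (h : ∃ t, Exec p s t s' ∧ t ≤ c.eval N) (h' : ∃ t, Exec p' s' t s'' ∧ t ≤ c'.eval N) :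
    ∃ t, Exec (.seq p p') s t s'' ∧ t ≤ (c + c').eval N := by
  obtain ⟨t, h, ht⟩ := h
  obtain ⟨t', h', ht'⟩ := h'
  exact ⟨t + t', .seq h h', by rw [Polynomial.eval_add]; omega⟩

theorem exec_matchingProg (r n : ℕ) (G : SimpleGraph (Fin n)) (hG : IsChordal G) :
    ∃ t s, Exec (matchingProg r) (graphInput G) t s ∧
      t ≤ (matchingCost r).eval ((n + 2) ^ (5 * (r + 1))) ∧
      IsGreatest (degenerateMatchingSizes G r) (s.reg 0) := by
  -- `N` is the number of cells of the table and bounds all variables at all times.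
  set N := (n + 2) ^ (5 * (r + 1)) with hN
  set M := (n + 2) ^ (r + 1) with hM
  have hNM : N = M * M * M * M * M := by
    rw [hN, hM, mul_comm 5, pow_mul]
    ring
  have hM2 : n + 2 ≤ M := by
    rw [hM, pow_succ]
    exact Nat.le_mul_of_pos_left _ (Nat.pow_pos (by omega))
  have hMN : M ≤ N := by
    rw [hNM]
    exact Nat.le_mul_of_pos_left _ (by positivity)
  have env0 : ∀ i, (graphInput G).env i = if i = 0 then n else 0 := by
    intro i
    simp [State.env, graphInput]
  have arr0 : ∀ a, a ≠ 0 → ∀ x, (graphInput G).arr a x = 0 := by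
    intro a ha x
    simp [graphInput, ha]
  obtain ⟨t₁, s₁, x₁, b₁, e₁, a₁⟩ := exec_assign 1 (add (var 0) (num 2)) N (graphInput G) (by
    intro i
    rw [env0]
    split_ifs <;> omega)
  simp only [eval, env0, if_true] at e₁
  obtain ⟨t₂, s₂, x₂, b₂, e₂, a₂⟩ := exec_assign 2 (powE (r + 1)) N s₁ (by
    intro i
    rw [e₁, Function.update_apply, env0]
    split_ifs <;> omega)
  rw [eval_powE, e₁, Function.update_self, ← hM] at e₂
  obtain ⟨t₃, s₃, x₃, b₃, e₃, a₃⟩ := exec_assign 3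
    (mulv (mulv (mulv (mulv (var 2) 2) 2) 2) 2) N s₂ (by
    intro i
    rw [e₂, Function.update_apply, Function.update_apply, env0]
    split_ifs <;> omega)
  simp only [eval, e₂, Function.update_self, ← hNM] at e₃
  have hset : Setting n (n + 2) M s₃.env := by
    refine ⟨?_, ?_, ?_⟩ <;> rw [e₃] <;> simp [env0]
  have h3 : s₃.env 3 = N := by rw [e₃, Function.update_self]
  have h4 : s₃.env 4 = 0 := by rw [e₃]; simp [env0]
  have hbd : ∀ i, s₃.env i ≤ N := by
    intro i
    rw [e₃, Function.update_apply, Function.update_apply, Function.update_apply, env0]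
    split_ifs <;> omega
  have ha : s₃.arr = (graphInput G).arr := by rw [a₃, a₂, a₁]
  obtain ⟨t₄, s₄, x₄, b₄, e₄, c₄, d₄⟩ := exec_tab 1 4 0 orderE N s₃ hbd h4
    (by rw [ha]; exact arr0 1 (by omega))
  obtain ⟨t₅, s₅, x₅, b₅, e₅, c₅, d₅⟩ := exec_tab 2 4 3 memberE N s₄ (by rwa [e₄])
    (by rwa [e₄]) (by rw [c₄ 2 (by omega), ha]; exact arr0 2 (by omega))
  obtain ⟨t₆, s₆, x₆, b₆, e₆, c₆, d₆⟩ := exec_tab 3 4 3 tableE N s₅ (by rwa [e₅, e₄])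
    (by rwa [e₅, e₄])
    (by rw [c₅ 3 (by omega), c₄ 3 (by omega), ha]; exact arr0 3 (by omega))
  obtain ⟨t₇, s₇, x₇, b₇, e₇, -⟩ := exec_assign 0 outputE N s₆ (by rwa [e₆, e₅, e₄])
  obtain ⟨t, x, b⟩ := Exec.seq_bounded ⟨t₁, x₁, b₁⟩ (Exec.seq_bounded ⟨t₂, x₂, b₂⟩
    (Exec.seq_bounded ⟨t₃, x₃, b₃⟩ (Exec.seq_bounded ⟨t₄, x₄, b₄⟩ (Exec.seq_bounded ⟨t₅, x₅, b₅⟩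
    (Exec.seq_bounded ⟨t₆, x₆, b₆⟩ ⟨t₇, x₇, b₇⟩)))))
  refine ⟨t, s₇, x, by unfold matchingCost; exact b, ?_⟩
  · have hreg : s₇.reg 0 = outputE.eval s₆.env s₆.arr := by
      change s₇.env 0 = _
      rw [e₇, Function.update_self]
    rw [hreg, e₆, e₅, e₄]
    rw [e₅, e₄] at d₆
    rw [e₄] at d₅
    refine isGreatest_outputE hG hset (h3.trans hNM) ?_ ?_ ?_ ?_ d₄ d₅ d₆
    · rw [c₆ 0 (by omega), c₅ 0 (by omega), c₄ 0 (by omega), ha]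
    · rw [c₆ 0 (by omega), c₅ 0 (by omega)]
    · rw [c₆ 1 (by omega), c₅ 1 (by omega)]
    · exact (c₆ 2 (by omega)).symm

end RAM

theorem theorem3 (r : ℕ) (hr : 1 ≤ r) :
    ∃ (p : RAM.Prog) (q : Polynomial ℕ),
      ∀ (n : ℕ) (G : SimpleGraph (Fin n)), IsChordal G →
        ∃ (t : ℕ) (s : RAM.State),
          RAM.Exec p (RAM.graphInput G) t s ∧ t ≤ q.eval n ∧
            IsGreatest (degenerateMatchingSizes G r) (s.reg 0) := by
  refine ⟨RAM.matchingProg r,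
    (RAM.matchingCost r).comp ((Polynomial.X + 2) ^ (5 * (r + 1))), fun n G hG => ?_⟩
  obtain ⟨t, s, h, ht, hs⟩ := RAM.exec_matchingProg r n G hG
  refine ⟨t, s, h, ?_, hs⟩
  simpa [Polynomial.eval_comp] using ht
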